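/- By a curve over a field $k$ we mean a smooth projective geometrically irreducible variety of dimension $1$ over $k$. Let $C$ be a curve over $\mathbb{Q}$ of genus $g \ge 2$, let $E$ be a curve over $\mathbb{Q}$ of genus $1$, and let $\pi : C \to E$ be a morphism of degree $2$ defined over $\mathbb{Q}$ (so that $C$ is bielliptic). Let $J$ be the Jacobian of $C$ and suppose that $J(\mathbb{Q})$ is finite. Let $d$ be an integer with $2 \le d \le g-2$. For $P \in C(\overline{\mathbb{Q}})$, the degree of $P$ is $[\mathbb{Q}(P):\mathbb{Q}]$, and $P$ is called primitive if there is no field $L$ with $\mathbb{Q} \subsetneq L \subsetneq \mathbb{Q}(P)$; the degree of a point of $E(\overline{\mathbb{Q}})$ is defined in the same way. Then $C$ has only finitely many primitive points $P \in C(\overline{\mathbb{Q}})$ of degree $d$. More precisely: (i) If $d = 2$ or $d$ is odd, then $C$ has only finitely many points $P \in C(\overline{\mathbb{Q}})$ of degree $d$. (ii) If $d \ge 4$ and $d$ is even, then for all but finitely many points $P \in C(\overline{\mathbb{Q}})$ of degree $d$, the image $\pi(P) \in E(\overline{\mathbb{Q}})$ has degree $d/2$, and therefore the degree $d$ field $\mathbb{Q}(P)$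 contains the degree $d/2$ subfield $\mathbb{Q}(\pi(P))$. -/

import Mathlib

open AlgebraicGeometry CategoryTheory CategoryTheory.Limits

noncomputable section

universe u

/-- A curve over a field `k`: a smooth, projective, geometrically irreducible variety of
dimension `1` over `k`.  A smooth one-dimensional `k`-scheme is projective if and only if it is
proper, and, being geometrically reduced, it is geometrically irreducible if and only if it is
geometrically integral. -/
structure Curve (k : Type u) [Field k] where
  /-- the underlying scheme -/
  toScheme : Scheme.{u}
  /-- the structure morphism to `Spec k` -/
  str : toScheme ⟶ Spec (.of k)
  smooth : SmoothOfRelativeDimension 1 str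
  proper : IsProper str
  geometricallyIntegral : GeometricallyIntegral str

namespace Curve

section General

variable {k : Type u} [Field k] (C : Curve k)

instance : SmoothOfRelativeDimension 1 C.str := C.smooth

instance : IsProper C.str := C.proper

instance : GeometricallyIntegral C.str := C.geometricallyIntegral

instance : IsIntegral C.toScheme :=
  GeometricallyIntegral.isIntegral_of_subsingleton C.str

instance : IsLocallyNoetherian C.toScheme :=
  LocallyOfFiniteType.isLocallyNoetherian C.str

/-- The base change `C_K = C ×_{Spec k} Spec K` of a curve along a field extension `K / k`. -/
def baseChange (K : Type u) [Field K] [Algebra k K] : Curve K where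
  toScheme := pullback C.str (Spec.map (CommRingCat.ofHom (algebraMap k K)))
  str := pullback.snd _ _
  smooth := (smoothOfRelativeDimension_isStableUnderBaseChange 1).of_isPullback
    (IsPullback.of_hasPullback C.str (Spec.map (CommRingCat.ofHom (algebraMap k K)))) C.smooth
  proper := inferInstance
  geometricallyIntegral := inferInstance

/-! ### Function field and genus -/

/-- The function field `k(C)`, as the stalk of the structure sheaf at the generic point. -/
abbrev FunctionField : Type u := C.toScheme.functionField

/-- The inclusion of the constants `k → Γ(C, 𝒪_C) → k(C)`. -/
def constants : k →+* C.FunctionField :=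
  (C.toScheme.presheaf.germ ⊤ (genericPoint C.toScheme) (Set.mem_univ _)).hom.comp
    (C.str.appTop.hom.comp (Scheme.ΓSpecIso (.of k)).inv.hom)

instance : Algebra k C.FunctionField := C.constants.toAlgebra

/-- The local ring `𝒪_{C,x}`, as a `k`-subspace of `k(C)`. -/
def localRing (x : C.toScheme) : Submodule k C.FunctionField where
  carrier := Set.range (algebraMap (C.toScheme.presheaf.stalk x) C.FunctionField)
  add_mem' := by
    rintro _ _ ⟨a, rfl⟩ ⟨b, rfl⟩
    exact ⟨a + b, map_add _ a b⟩
  zero_mem' := ⟨0, map_zero _⟩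
  smul_mem' := by
    rintro c _ ⟨a, rfl⟩
    refine ⟨C.toScheme.presheaf.germ ⊤ x (Set.mem_univ x)
      (C.str.appTop.hom ((Scheme.ΓSpecIso (.of k)).inv.hom c)) * a, ?_⟩
    have : Nonempty (⊤ : C.toScheme.Opens) := ⟨⟨x, Set.mem_univ x⟩⟩
    rw [map_mul, Algebra.smul_def]
    exact congrArg (· * _) (Scheme.algebraMap_germ_eq_germToFunctionField C.toScheme
      (U := ⊤) (x := x) (Set.mem_univ x) _)

/-- The repartitions of `C`: families `(r_x)` of rational functions indexed by the points of `C`,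
with `r_x ∈ 𝒪_{C,x}` for all but finitely many `x`.  (The only point that is not closed is the
generic point, whose local ring is all of `k(C)`, so it imposes no condition and contributes
nothing to the quotient `H1` below.) -/
def repartitions : Submodule k (C.toScheme → C.FunctionField) where
  carrier := {r | {x | r x ∉ C.localRing x}.Finite}
  add_mem' := by
    intro r s hr hs
    refine (hr.union hs).subset fun x hx => ?_
    by_contra h
    simp only [Set.mem_union, Set.mem_ofPred_eq, not_or, not_not] at h
    exact hx (add_mem h.1 h.2)
  zero_mem' := by simp
  smul_mem' := by
    intro c r hr
    exact Set.Finite.subset hr fun x hx h => hx (Submodule.smul_mem _ c h)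

/-- The repartitions that are regular at every point. -/
def regularRepartitions : Submodule k (C.toScheme → C.FunctionField) where
  carrier := {r | ∀ x, r x ∈ C.localRing x}
  add_mem' := fun hr hs x => add_mem (hr x) (hs x)
  zero_mem' := fun _ => zero_mem _
  smul_mem' := fun c _ hr x => Submodule.smul_mem _ c (hr x)

/-- The constant families `(f)_x` for `f ∈ k(C)`. -/
def constantRepartitions : Submodule k (C.toScheme → C.FunctionField) :=
  LinearMap.range (LinearMap.pi fun _ : C.toScheme =>
    (LinearMap.id : C.FunctionField →ₗ[k] C.FunctionField))

/-- The cohomology group `H¹(C, 𝒪_C)`, computed by the flasque resolution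
`0 → 𝒪_C → k(C) → ⨁_x k(C) / 𝒪_{C,x} → 0`: it is the cokernel of
`k(C) → ⨁_x k(C) / 𝒪_{C,x}`, that is, the space of repartitions modulo the regular ones and
the rational functions. -/
abbrev H1 : Type u :=
  C.repartitions ⧸
    (C.regularRepartitions ⊔ C.constantRepartitions).comap C.repartitions.subtype

/-- The genus of `C`: the dimension of `H¹(C_{k̄}, 𝒪)`, where `k̄` is the algebraic closure
of `k`. -/
def genus : ℕ :=
  Module.finrank (AlgebraicClosure k) (C.baseChange (AlgebraicClosure k)).H1

/-! ### Points -/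

/-- The set `C(K)` of `K`-valued points of `C`, that is, of morphisms `Spec K → C` over `k`. -/
def Points (K : Type u) [Field K] [Algebra k K] : Type u :=
  {P : Spec (.of K) ⟶ C.toScheme // P ≫ C.str = Spec.map (CommRingCat.ofHom (algebraMap k K))}

namespace Points

variable {C} {K : Type u} [Field K] [Algebra k K]

/-- The field `k(P) ⊆ K` of a point `P ∈ C(K)`: the image in `K` of the residue field of `C` at
the point that underlies `P`. -/
def field (P : C.Points K) : IntermediateField k K :=
  IntermediateField.adjoin k
    (Set.range ((Scheme.SpecToEquivOfField K C.toScheme P.1).2).hom)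

/-- The degree `[k(P) : k]` of a point. -/
def degree (P : C.Points K) : ℕ := Module.finrank k P.field

/-- A point `P` is primitive if there is no field strictly between `k` and `k(P)`. -/
def IsPrimitive (P : C.Points K) : Prop :=
  ∀ L : IntermediateField k K, L ≤ P.field → L = ⊥ ∨ L = P.field

/-- The image `π(P)` of a point under a morphism of curves over `k`. -/
def map {E : Curve k} (π : C.toScheme ⟶ E.toScheme) (hπ : π ≫ E.str = C.str)
    (P : C.Points K) : E.Points K :=
  ⟨P.1 ≫ π, by rw [Category.assoc, hπ, P.2]⟩

/-- The conjugate `σ(P)` of a point `P ∈ C(K)` by an automorphism `σ` of `K / k`. -/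
def conj (σ : K ≃ₐ[k] K) (P : C.Points K) : C.Points K :=
  ⟨Spec.map (CommRingCat.ofHom (σ : K →+* K)) ≫ P.1, by
    rw [Category.assoc, P.2, ← Spec.map_comp, ← CommRingCat.ofHom_comp]
    congr 2
    ext c
    simp⟩

/-- The closed point of `C_K` given by a point `P ∈ C(K)`. -/
def closedPoint (P : C.Points K) : (C.baseChange K).toScheme :=
  (pullback.lift P.1 (𝟙 _) (by rw [P.2, Category.id_comp]) :
    Spec (.of K) ⟶ pullback C.str (Spec.map (CommRingCat.ofHom (algebraMap k K))))
    (IsLocalRing.closedPoint K)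

end Points

/-- The degree `[k(C) : k(E)]` of a non-constant morphism `π : C → E` of curves (a non-constant
morphism sends the generic point of `C` to that of `E`). -/
def morphismDegree {C E : Curve k} (π : C.toScheme ⟶ E.toScheme) : ℕ :=
  letI := (π.stalkMap (genericPoint C.toScheme)).hom.toAlgebra
  Module.finrank (E.toScheme.presheaf.stalk (π (genericPoint C.toScheme))) C.FunctionField

/-- `π : C → E` exhibits `C` as a bielliptic curve: `C` has genus at least `2`, `E` has genus `1`,
and `π` is a (non-constant) morphism over `k` of degree `2`. -/
structure IsBiellipticMap {C E : Curve k} (π : C.toScheme ⟶ E.toScheme) : Prop where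
  comp_str : π ≫ E.str = C.str
  dominant : IsDominant π
  degree_eq_two : morphismDegree π = 2
  two_le_genus : 2 ≤ C.genus
  genus_eq_one : E.genus = 1

end General

/-! ### Divisors over the algebraic closure and the rational points of the Jacobian -/

section Jacobian

variable {k : Type u} [Field k] (C : Curve k)

/-- The algebraic points of `C`, that is, the set `C(k̄)`. -/
abbrev AlgPoints : Type u := C.Points (AlgebraicClosure k)

/-- Divisors on `C_{k̄}`: finite formal integral linear combinations of points of `C(k̄)`. -/
abbrev GeomDivisor : Type u := C.AlgPoints →₀ ℤ

/-- The degree `∑ n_P` of a divisor `∑ n_P P` on `C_{k̄}`. -/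
def divisorDegree : C.GeomDivisor →+ ℤ :=
  Finsupp.liftAddHom fun _ => AddMonoidHom.id ℤ

/-- The action of `σ ∈ Gal(k̄ / k)` on divisors, `∑ n_P P ↦ ∑ n_P σ(P)`. -/
def divisorConj (σ : AlgebraicClosure k ≃ₐ[k] AlgebraicClosure k) : C.GeomDivisor →+ C.GeomDivisor :=
  Finsupp.mapDomain.addMonoidHom (Points.conj σ)

/-- The principal divisors on `C_{k̄}`: those of the form `∑ ord_P(f) P` with
`f ∈ k̄(C)`, `f ≠ 0`. -/
def principalDivisors : AddSubgroup C.GeomDivisor where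
  carrier := {D | ∃ f : (C.baseChange (AlgebraicClosure k)).FunctionField, f ≠ 0 ∧
    ∀ P : C.AlgPoints, D P = Scheme.ord f P.closedPoint}
  add_mem' := by
    rintro D D' ⟨f, hf, h⟩ ⟨f', hf', h'⟩
    refine ⟨f * f', mul_ne_zero hf hf', fun P => ?_⟩
    rw [Scheme.ord_mul hf hf', Finsupp.add_apply, h, h']
  zero_mem' := by
    refine ⟨1, one_ne_zero, fun P => ?_⟩
    have h := Scheme.ord_mul (x := P.closedPoint)
      (one_ne_zero (α := (C.baseChange (AlgebraicClosure k)).FunctionField)) one_ne_zero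
    rw [mul_one] at h
    rw [Finsupp.zero_apply]
    omega
  neg_mem' := by
    rintro D ⟨f, hf, h⟩
    refine ⟨f⁻¹, inv_ne_zero hf, fun P => ?_⟩
    have h1 := Scheme.ord_mul (x := P.closedPoint)
      (one_ne_zero (α := (C.baseChange (AlgebraicClosure k)).FunctionField)) one_ne_zero
    have h2 := Scheme.ord_mul (x := P.closedPoint) hf (inv_ne_zero hf)
    rw [mul_inv_cancel₀ hf] at h2
    rw [mul_one] at h1
    rw [Finsupp.neg_apply, h]
    omega

/-- The divisors `D` of degree `0` on `C_{k̄}` whose class is fixed by `Gal(k̄ / k)`, that is,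
with `σ(D)` linearly equivalent to `D` for all `σ`. -/
def invariantClassDivisors : AddSubgroup C.GeomDivisor where
  carrier := {D | C.divisorDegree D = 0 ∧
    ∀ σ : AlgebraicClosure k ≃ₐ[k] AlgebraicClosure k, C.divisorConj σ D - D ∈ C.principalDivisors}
  add_mem' := by
    rintro D D' ⟨h, hσ⟩ ⟨h', hσ'⟩
    refine ⟨by rw [map_add, h, h', add_zero], fun σ => ?_⟩
    rw [map_add, add_sub_add_comm]
    exact add_mem (hσ σ) (hσ' σ)
  zero_mem' := ⟨map_zero _, fun σ => by rw [map_zero, sub_zero]; exact zero_mem _⟩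
  neg_mem' := by
    rintro D ⟨h, hσ⟩
    refine ⟨by rw [map_neg, h, neg_zero], fun σ => ?_⟩
    rw [map_neg, ← neg_sub']
    exact neg_mem (hσ σ)

/-- The group `J(k)` of rational points of the Jacobian `J` of a curve `C` over a perfect field `k`
(for instance `k = ℚ`).  Since `J(k̄) = Pic⁰(C_{k̄})`
as Galois modules, `J(k)` is the group of divisor classes of degree `0` on `C_{k̄}` that are
fixed by `Gal(k̄ / k)`.  (When `C(k)` is empty, such a class need not contain a divisor that is
itself fixed by `Gal(k̄ / k)`.) -/
def jacobianRationalPoints {k : Type u} [Field k] [PerfectField k] (C : Curve k) :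
    AddSubgroup (C.GeomDivisor ⧸ C.principalDivisors) :=
  C.invariantClassDivisors.map (QuotientAddGroup.mk' C.principalDivisors)

end Jacobian

end Curve

end

/-! Two points of degree `d` whose Galois orbits `D`, `D'` have linearly equivalent sums give, if
the orbits are distinct, a function `f` over `k̄` with `div f = D - D'`: all its zeros and poles are
simple, and there are `d ≤ g - 2` of each. The inequality of Castelnuovo and Severi for the double
cover `π` (`finrank_H1_le_card_add_one`) gives `g ≤ d + 1` unless `f` is a pullback `π^* g` from `E`
(`IsDoubleCover.exists_conj`). Hence `f = π^* g`. As the zeros of `f` are simple, `π` is unramified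
there, and `D` is a union of full fibres with two points each, so `d = 2 deg π(P)`. If moreover `d =
2`, then `g` has a single simple pole on `E`, which genus one forbids
(`finrank_H1_ne_one_of_simple_pole`). This is `orbit_ncard_eq_two_mul`.

Now let `S` be the set of points of degree `d` for which "`d` is even, `d ≠ 2` and `deg π(P) = d /
2`" fails. Two points of `S` with the same class in `J(k)`, relative to a fixed base point of `S`,
are therefore conjugate. Since `J(k)` is finite and orbits are finite, `S` is finite
(`finite_degree_eq_and_not`), and the three assertions follow from `k(π(P)) ⊆ k(P)`.

The genus is the dimension of repartitions modulo regular and constant ones, so both genus estimates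
are proved for abstract families of valuation rings. The geometry enters through
`Curve.isPlaceFamily`, which identifies the points of a curve over an algebraically closed field
with the valuation rings of its function field, and through `Curve.isDoubleCover_baseChange`. -/

noncomputable section

/-! ### Discrete valuation rings of a field and weak approximation. -/

namespace ValuationSubring

variable {F : Type*} [Field F]

/-- The valuation of `V` is discrete: it has a uniformizer. -/
def IsDiscrete (V : ValuationSubring F) : Prop :=
  ∃ t : F, t ≠ 0 ∧ V.valuation t < 1 ∧ ∀ a : F, a ≠ 0 → ∃ n : ℤ, V.valuation a = V.valuation t ^ n

/-- `f` generates the maximal ideal of `V`. -/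
def IsUniformizer (V : ValuationSubring F) (f : F) : Prop :=
  V.valuation f < 1 ∧ ∀ a : F, V.valuation a < 1 → V.valuation a ≤ V.valuation f

lemma IsDiscrete.ne_top {V : ValuationSubring F} (hV : V.IsDiscrete) : V ≠ ⊤ := by
  obtain ⟨t, ht, h1, -⟩ := hV
  rintro rfl
  have : t⁻¹ ∈ (⊤ : ValuationSubring F) := trivial
  rw [← valuation_le_one_iff, map_inv₀] at this
  have h0 : (⊤ : ValuationSubring F).valuation t ≠ 0 := by simpa using ht
  rw [inv_le_one₀ (zero_lt_iff.2 h0)] at this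
  exact absurd h1 (not_lt.2 this)

lemma IsDiscrete.exists_pow_lt {V : ValuationSubring F} (hV : V.IsDiscrete) {m : F}
    (hm : V.valuation m < 1) (a : F) :
    ∃ N : ℕ, ∀ n, N ≤ n → V.valuation (a * m ^ n) < 1 := by
  by_cases hm0 : m = 0
  · exact ⟨1, fun n hn => by simp [hm0, Nat.one_le_iff_ne_zero.1 hn]⟩
  by_cases ha0 : a = 0
  · exact ⟨0, fun n _ => by simp [ha0]⟩
  obtain ⟨t, ht, h1, h⟩ := hV
  have h0 : 0 < V.valuation t := zero_lt_iff.2 (by simpa using ht)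
  obtain ⟨k, hk⟩ := h m hm0
  obtain ⟨l, hl⟩ := h a ha0
  have hk1 : 1 ≤ k := by
    by_contra! hlt
    rw [hk] at hm
    exact absurd hm (not_lt.2 (one_le_zpow_of_nonpos₀ h0 h1.le (by omega)))
  refine ⟨l.natAbs + 1, fun n hn => ?_⟩
  rw [map_mul, map_pow, hk, hl, ← zpow_natCast, ← zpow_mul, ← zpow_add₀ h0.ne']
  refine (zpow_lt_one_iff_right_of_lt_one₀ h0 h1).2 ?_
  nlinarith [neg_abs_le l, Int.natCast_natAbs l]

/-- If `a` lies in `W` but not in `V`, then for each `b` a high power of `a⁻¹` pulls `b` into `V`,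
and multiplying back by that power of `a` puts `b` in `W`. Distinct discrete valuation rings are
thus incomparable, which is what approximation needs. -/
lemma IsDiscrete.eq_of_le {V W : ValuationSubring F} (hV : V.IsDiscrete) (hle : V ≤ W)
    (hW : W ≠ ⊤) : V = W := by
  refine le_antisymm hle fun a ha => ?_
  by_contra haV
  apply hW
  refine top_le_iff.1 fun b _ => ?_
  have hlt : V.valuation a⁻¹ < 1 := by
    rw [← mem_nonunits_iff, inv_mem_nonunits_iff]; exact Or.inr haV
  have ha0 : a ≠ 0 := by rintro rfl; exact haV V.zero_mem
  obtain ⟨N, hN⟩ := hV.exists_pow_lt hlt b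
  have hb := hle ((V.valuation_le_one_iff _).1 (hN N le_rfl).le)
  have := W.mul_mem _ _ hb (pow_mem ha N)
  rwa [mul_assoc, ← mul_pow, inv_mul_cancel₀ ha0, one_pow, mul_one] at this

/-- The substitution `z ↦ z / (1 + z)` turns poles into values `1`; by the next lemma it keeps
zeros. -/
lemma valuation_sub_one_lt {V : ValuationSubring F} {z : F} (hz : z ∉ V) :
    V.valuation (z / (1 + z) - 1) < 1 := by
  have hv : 1 < V.valuation z := not_le.1 fun h => hz ((V.valuation_le_one_iff _).1 h)
  have h1 : V.valuation (1 + z) = V.valuation z := by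
    rw [Valuation.map_add_eq_of_lt_right _ (by simpa using hv)]
  have hne : 1 + z ≠ 0 := by
    intro h; rw [h, map_zero] at h1; rw [← h1] at hv; exact absurd hv (by simp)
  have : z / (1 + z) - 1 = - (1 + z)⁻¹ := by field_simp; ring
  rw [this, Valuation.map_neg, map_inv₀, h1]
  exact inv_lt_one_of_one_lt₀ hv

lemma valuation_div_one_add_lt {V : ValuationSubring F} {z : F} (hz : V.valuation z < 1) :
    V.valuation (z / (1 + z)) < 1 := by
  have h1 : V.valuation (1 + z) = 1 := by
    rw [Valuation.map_add_eq_of_lt_left _ (by simpa using hz), map_one]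
  rwa [map_div₀, h1, div_one]

/-- An element that vanishes at `V` and has a pole at each of the finitely many `W ∈ T`. -/
lemma exists_pole (V : ValuationSubring F) (T : Finset (ValuationSubring F))
    (h : ∀ W ∈ T, ¬ V ≤ W ∧ ¬ W ≤ V) :
    ∃ z : F, V.valuation z < 1 ∧ ∀ W ∈ T, z ∉ W := by
  classical
  induction T using Finset.induction_on with
  | empty => exact ⟨0, by simp, by simp⟩
  | insert W T hWT ih =>
    obtain ⟨z, hz, hzT⟩ := ih fun W' hW' => h W' (Finset.mem_insert_of_mem hW')
    by_cases hzW : z ∈ W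
    swap
    · refine ⟨z, hz, fun W' hW' => ?_⟩
      rcases Finset.mem_insert.1 hW' with rfl | h'
      exacts [hzW, hzT _ h']
    obtain ⟨h1, h2⟩ := h W (Finset.mem_insert_self _ _)
    obtain ⟨a, haV, haW⟩ := SetLike.not_le_iff_exists.1 h1
    obtain ⟨b, hbW, hbV⟩ := SetLike.not_le_iff_exists.1 h2
    have hbi : V.valuation b⁻¹ < 1 := by
      rw [← mem_nonunits_iff, inv_mem_nonunits_iff]; exact Or.inr hbV
    have hb0 : b ≠ 0 := by rintro rfl; exact hbV V.zero_mem
    set w := a * b⁻¹ with hw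
    have hwV : V.valuation w < 1 := by
      rw [hw, map_mul]
      exact mul_lt_one_of_nonneg_of_lt_one_right ((V.valuation_le_one_iff _).2 haV) zero_le hbi
    have hwW : w ∉ W := fun hmem => haW (by
      have := W.mul_mem _ _ hmem hbW
      rwa [hw, mul_assoc, inv_mul_cancel₀ hb0, mul_one] at this)
    -- Each `W'` excludes at most one exponent. For a positive `n` outside these finitely many
    -- exceptions nothing cancels in `z + w ^ n` at the places of `T`, so the poles of `z` survive,
    -- while `w ^ n` supplies the new pole at `W`.
    have hbad : ∀ W' ∈ T, {n : ℕ | W'.valuation z = W'.valuation (w ^ n)}.Subsingleton := by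
      intro W' hW' n hn m hm
      have hz' : 1 < W'.valuation z := not_le.1 fun h => hzT W' hW' ((W'.valuation_le_one_iff _).1 h)
      simp only [Set.mem_ofPred_eq, map_pow] at hn hm
      have hw1 : 1 < W'.valuation w := by
        by_contra! hle
        rw [hn] at hz'
        exact absurd hz' (not_lt.2 (pow_le_one' hle n))
      exact pow_right_injective₀ (zero_lt_one.trans hw1) hw1.ne' (hn.symm.trans hm)
    have hfin : (⋃ W' ∈ T, {n : ℕ | W'.valuation z = W'.valuation (w ^ n)}).Finite :=
      T.finite_toSet.biUnion fun W' hW' => (hbad W' hW').finite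
    obtain ⟨n, hn⟩ := (hfin.union (Set.finite_singleton 0)).exists_notMem
    simp only [Set.mem_union, Set.mem_iUnion, Set.mem_ofPred_eq, Set.mem_singleton_iff, not_or,
      not_exists] at hn
    obtain ⟨hn, hn0⟩ := hn
    refine ⟨z + w ^ n, ?_, fun W' hW' hmem => ?_⟩
    · refine Valuation.map_add_lt _ hz ?_
      rw [map_pow]; exact pow_lt_one' hwV hn0
    rcases Finset.mem_insert.1 hW' with rfl | h'
    · have hwn : w ^ n ∈ W' := by simpa using W'.sub_mem hmem hzW
      rw [← valuation_le_one_iff, map_pow] at hwn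
      have h3 : 1 < W'.valuation w := not_le.1 fun h => hwW ((W'.valuation_le_one_iff _).1 h)
      exact absurd hwn (not_le.2 (one_lt_pow₀ h3 hn0))
    · have hne := hn W' h'
      have hz' : 1 < W'.valuation z := not_le.1 fun h => hzT W' h' ((W'.valuation_le_one_iff _).1 h)
      rw [← valuation_le_one_iff, Valuation.map_add_of_distinct_val _ hne] at hmem
      exact absurd (le_max_left _ _ |>.trans hmem) (not_le.2 hz')

lemma exists_approx_one (V : ValuationSubring F) (T : Finset (ValuationSubring F))
    (h : ∀ W ∈ T, ¬ V ≤ W ∧ ¬ W ≤ V) :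
    ∃ z : F, V.valuation (z - 1) < 1 ∧ ∀ W ∈ T, W.valuation z < 1 := by
  obtain ⟨z, hz, hzT⟩ := exists_pole V T h
  refine ⟨1 - z / (1 + z), ?_, fun W hW => ?_⟩
  · rw [sub_sub_cancel_left, Valuation.map_neg]; exact valuation_div_one_add_lt hz
  · rw [Valuation.map_sub_swap]; exact valuation_sub_one_lt (hzT W hW)

/-- Weak approximation for finitely many discrete valuation rings. -/
theorem exists_approx (T : Finset (ValuationSubring F)) (h : ∀ W ∈ T, W.IsDiscrete)
    (r : ValuationSubring F → F) : ∃ s : F, ∀ W ∈ T, W.valuation (s - r W) < 1 := by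
  classical
  have key : ∀ V ∈ T, ∃ s : F, V.valuation (s - r V) < 1 ∧ ∀ W ∈ T.erase V, W.valuation s < 1 := by
    intro V hV
    have hinc : ∀ W ∈ T.erase V, ¬ V ≤ W ∧ ¬ W ≤ V := fun W hW =>
      ⟨fun hle => (Finset.ne_of_mem_erase hW) ((h V hV).eq_of_le hle
        (h W (Finset.mem_of_mem_erase hW)).ne_top).symm,
      fun hle => (Finset.ne_of_mem_erase hW) ((h W (Finset.mem_of_mem_erase hW)).eq_of_le hle
        (h V hV).ne_top)⟩
    obtain ⟨z, hz, hzT⟩ := exists_approx_one V _ hinc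
    have hex : ∀ W ∈ T, ∃ N : ℕ, ∀ n, N ≤ n →
        (W = V → V.valuation (r V * (z - 1) ^ n) < 1) ∧ (W ≠ V → W.valuation (r V * z ^ n) < 1) := by
      intro W hW
      by_cases hWV : W = V
      · obtain ⟨N, hN⟩ := (h V hV).exists_pow_lt hz (r V)
        exact ⟨N, fun n hn => ⟨fun _ => hN n hn, fun h => absurd hWV h⟩⟩
      · obtain ⟨N, hN⟩ := (h W hW).exists_pow_lt (hzT W (Finset.mem_erase.2 ⟨hWV, hW⟩)) (r V)
        exact ⟨N, fun n hn => ⟨fun h => absurd h hWV, fun _ => hN n hn⟩⟩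
    choose! N hN using hex
    set n := T.sup N + 1 with hn
    have hle : ∀ W ∈ T, N W ≤ n := fun W hW => (Finset.le_sup hW).trans (Nat.le_succ _)
    -- The factor `1 - (1 - z ^ n) ^ n` differs from `1` by a multiple of `(z - 1) ^ n` and is
    -- itself a multiple of `z ^ n`. For large `n` the first outweighs the pole of `r V` at `V`, the
    -- second its poles at the other places.
    refine ⟨r V * (1 - (1 - z ^ n) ^ n), ?_, fun W hW => ?_⟩
    · have hdvd : (z - 1) ^ n ∣ (1 - z ^ n) ^ n := by
        refine pow_dvd_pow_of_dvd ?_ n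
        rw [← neg_sub (z ^ n) 1, dvd_neg]; simpa using sub_dvd_pow_sub_pow z 1 n
      have hz1 : V.valuation z ≤ 1 := by
        have := Valuation.map_add_le V.valuation hz.le (map_one V.valuation).le
        simpa using this
      have hfac : 1 - z ^ n = (z - 1) * (- ∑ i ∈ Finset.range n, z ^ i) := by
        rw [mul_neg, mul_geom_sum]; ring
      have hs : V.valuation (- ∑ i ∈ Finset.range n, z ^ i) ≤ 1 := by
        rw [Valuation.map_neg]
        exact Valuation.map_sum_le _ fun i _ => by rw [map_pow]; exact pow_le_one' hz1 i
      have : r V * (1 - (1 - z ^ n) ^ n) - r V =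
          - ((r V * (z - 1) ^ n) * (- ∑ i ∈ Finset.range n, z ^ i) ^ n) := by
        rw [hfac, mul_pow]; ring
      rw [this, Valuation.map_neg, map_mul]
      refine mul_lt_one_of_nonneg_of_lt_one_left zero_le ((hN V hV n (hle V hV)).1 rfl) ?_
      rw [map_pow]; exact pow_le_one' hs n
    · have hWT := Finset.mem_of_mem_erase hW
      have hz1 : W.valuation (1 - z ^ n) ≤ 1 := by
        refine (Valuation.map_sub _ _ _).trans ?_
        rw [map_one, map_pow]
        exact max_le le_rfl (pow_le_one' (hzT W hW).le n)
      have hfac : r V * (1 - (1 - z ^ n) ^ n) =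
          (r V * z ^ n) * ∑ i ∈ Finset.range n, (1 - z ^ n) ^ i := by
        have := mul_neg_geom_sum (1 - z ^ n) n
        rw [← this]; ring
      have hs : W.valuation (∑ i ∈ Finset.range n, (1 - z ^ n) ^ i) ≤ 1 :=
        Valuation.map_sum_le _ fun i _ => by rw [map_pow]; exact pow_le_one' hz1 i
      rw [hfac, map_mul]
      exact mul_lt_one_of_nonneg_of_lt_one_left zero_le
        ((hN W hWT n (hle W hWT)).2 (Finset.ne_of_mem_erase hW)) hs
  choose! s hs using key
  refine ⟨∑ V ∈ T, s V, fun W hW => ?_⟩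
  rw [← Finset.add_sum_erase _ _ hW, add_sub_right_comm]
  refine Valuation.map_add_lt _ (hs W hW).1 (Valuation.map_sum_lt _ one_ne_zero fun V hV => ?_)
  exact (hs V (Finset.mem_of_mem_erase hV)).2 W
    (Finset.mem_erase.2 ⟨(Finset.ne_of_mem_erase hV).symm, hW⟩)

end ValuationSubring

/-! ### Valuation rings in a quadratic extension. -/

namespace ValuationSubring

variable {F : Type*} [Field F]

lemma valuation_comap_lt_one_iff {L : Type*} [Field L] (V : ValuationSubring F) (f : L →+* F)
    (a : L) : (V.comap f).valuation a < 1 ↔ V.valuation (f a) < 1 := by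
  rw [← mem_nonunits_iff, ← mem_nonunits_iff, mem_nonunits_iff_or, mem_nonunits_iff_or,
    mem_comap, map_inv₀, map_eq_zero]

lemma valuation_algebraMap_eq_one {K : Type*} [Field K] [Algebra K F] {V : ValuationSubring F}
    (hV : ∀ c : K, algebraMap K F c ∈ V) {c : K} (hc : c ≠ 0) :
    V.valuation (algebraMap K F c) = 1 := by
  have h1 := (V.valuation_le_one_iff _).2 (hV c)
  have h2 := (V.valuation_le_one_iff _).2 (hV c⁻¹)
  rw [map_inv₀, map_inv₀] at h2
  have h0 : 0 < V.valuation (algebraMap K F c) := zero_lt_iff.2 (by simpa using hc)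
  exact le_antisymm h1 ((inv_le_one₀ h0).1 h2)

lemma IsDiscrete.exists_zpow {V : ValuationSubring F} (hV : V.IsDiscrete) {f : F}
    (hf : V.IsUniformizer f) : f ≠ 0 ∧
    ∀ a : F, a ≠ 0 → ∃ n : ℤ, V.valuation a = V.valuation f ^ n := by
  obtain ⟨t, ht, h1, h⟩ := hV
  have h0 : 0 < V.valuation t := zero_lt_iff.2 (by simpa using ht)
  have hle := hf.2 t h1
  have hf0 : f ≠ 0 := by
    rintro rfl
    rw [map_zero] at hle
    exact absurd h0 (not_lt.2 hle)
  refine ⟨hf0, ?_⟩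
  obtain ⟨k, hk⟩ := h f hf0
  have hk1 : 1 ≤ k := by
    by_contra! hlt
    have := hf.1
    rw [hk] at this
    exact absurd this (not_lt.2 (one_le_zpow_of_nonpos₀ h0 h1.le (by omega)))
  have hle' : V.valuation f ≤ V.valuation t := by
    rw [hk]
    exact (zpow_le_zpow_right_of_le_one₀ h0 h1.le hk1).trans (by simp)
  rw [le_antisymm hle' hle]
  exact h

section Quadratic

variable {L : Type*} [Field L] [Algebra L F] (τ : F ≃ₐ[L] F)

/-- Two discrete valuation rings of a quadratic extension with the same restriction are conjugate. -/
theorem eq_or_eq_comap_of_comap_eq (hτ : ∀ a, τ (τ a) = a)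
    (hfix : ∀ a, τ a = a → a ∈ Set.range (algebraMap L F)) {V W : ValuationSubring F}
    (hV : V.IsDiscrete) (hW : W.IsDiscrete) (hV' : (V.comap (τ : F →+* F)).IsDiscrete)
    (hW' : (W.comap (τ : F →+* F)).IsDiscrete)
    (h : V.comap (algebraMap L F) = W.comap (algebraMap L F)) :
    W = V ∨ W = V.comap (τ : F →+* F) := by
  classical
  by_contra! hne
  obtain ⟨h1, h2⟩ := hne
  have hcc : ∀ U : ValuationSubring F, (U.comap (τ : F →+* F)).comap (τ : F →+* F) = U := by
    intro U; ext a; simp [mem_comap, hτ]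
  set V' := V.comap (τ : F →+* F) with hV'd
  set W' := W.comap (τ : F →+* F) with hW'd
  have h3 : W' ≠ V := by
    intro h; apply h2; rw [hV'd, ← h, hcc]
  have h4 : W' ≠ V' := by
    intro h; apply h1; rw [← hcc W, ← hcc V, ← hW'd, ← hV'd, h]
  -- Choose `s` close to `1` at `V`, `V'` and to `0` at `W`, `W'`. Its norm `s * τ s` comes from
  -- `L`, vanishes at `W` and is a unit at `V`, although `V` and `W` restrict to the same ring of
  -- `L`.
  obtain ⟨s, hs⟩ := exists_approx {V, V', W, W'} (by
      intro U hU
      simp only [Finset.mem_insert, Finset.mem_singleton] at hU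
      rcases hU with rfl | rfl | rfl | rfl <;> assumption)
    (fun U => if U = V ∨ U = V' then 1 else 0)
  have a1 := hs V (by simp)
  have a2 := hs V' (by simp)
  have a3 := hs W (by simp)
  have a4 := hs W' (by simp)
  simp only [true_or, or_true, if_true] at a1 a2
  rw [if_neg (by simp [h1, h2]), sub_zero] at a3
  rw [if_neg (by simp [h3, h4]), sub_zero] at a4
  rw [hV'd, valuation_comap_lt_one_iff] at a2
  rw [hW'd, valuation_comap_lt_one_iff] at a4
  obtain ⟨N, hN⟩ := hfix (s * τ s) (by rw [map_mul, hτ, mul_comm])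
  have b1 : W.valuation (algebraMap L F N) < 1 := by
    rw [hN, map_mul]
    exact mul_lt_one_of_nonneg_of_lt_one_left zero_le a3 a4.le
  have b2 : V.valuation (algebraMap L F N) < 1 := by
    rw [← valuation_comap_lt_one_iff] at b1 ⊢
    rwa [h]
  have c1 : V.valuation s = 1 := by
    have := Valuation.map_add_eq_of_lt_right V.valuation (x := s - 1) (y := 1) (by simpa using a1)
    simpa using this
  have c2 : V.valuation (τ s) = 1 := by
    have := Valuation.map_add_eq_of_lt_right V.valuation (x := τ s - 1) (y := 1) (by simpa using a2)
    simpa using this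
  rw [hN, map_mul, c1, c2, mul_one] at b2
  exact lt_irrefl _ b2

/-- A place at which some element of the subfield is a uniformizer is not fixed by the conjugation:
otherwise the quadratic extension would be unramified and inert, and the residue field is
algebraically closed. -/
theorem comap_ne_of_isUniformizer {K : Type*} [Field K] [CharZero K] [Algebra K F] [Algebra K L]
    [IsScalarTower K L F] {u : F} (hu : u ≠ 0) (hτu : τ u = -u) {V : ValuationSubring F}
    (hV : V.IsDiscrete) (hK : ∀ c : K, algebraMap K F c ∈ V)
    (hres : ∀ a ∈ V, ∃ c : K, V.valuation (a - algebraMap K F c) < 1) {h : L}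
    (hf : V.IsUniformizer (algebraMap L F h)) : V.comap (τ : F →+* F) ≠ V := by
  intro heq
  obtain ⟨hf0, hpow⟩ := hV.exists_zpow hf
  obtain ⟨n, hn⟩ := hpow u hu
  set f := algebraMap L F h
  set w := u * (f ^ n)⁻¹ with hw
  have hvf : V.valuation f ^ n ≠ 0 := zpow_ne_zero _ (by simpa using hf0)
  have hvw : V.valuation w = 1 := by
    rw [hw, map_mul, map_inv₀, map_zpow₀, hn, mul_inv_cancel₀ hvf]
  have hτw : τ w = -w := by
    rw [hw, map_mul, hτu, map_inv₀, map_zpow₀, AlgEquiv.commutes, neg_mul]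
  obtain ⟨c, hc⟩ := hres w ((V.valuation_le_one_iff _).1 hvw.le)
  have hc' : V.valuation (-w - algebraMap K F c) < 1 := by
    have := hc
    rw [← heq, valuation_comap_lt_one_iff] at this
    have h2 : (τ : F →+* F) (w - algebraMap K F c) = -w - algebraMap K F c := by
      change τ (w - algebraMap K F c) = _
      rw [map_sub, hτw, IsScalarTower.algebraMap_apply K L F, AlgEquiv.commutes]
    rwa [h2] at this
  have hsum := Valuation.map_add_lt _ hc hc'
  have h3 : w - algebraMap K F c + (-w - algebraMap K F c) = algebraMap K F (-2 * c) := by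
    rw [map_mul, map_neg, map_ofNat]; ring
  rw [h3] at hsum
  have hc0 : c = 0 := by
    by_contra hc0
    rw [valuation_algebraMap_eq_one hK (by simpa using hc0)] at hsum
    exact lt_irrefl _ hsum
  rw [hc0, map_zero, sub_zero, hvw] at hc
  exact lt_irrefl _ hc

end Quadratic

end ValuationSubring

/-- The conjugation of a quadratic extension of characteristic zero. -/
theorem exists_quadratic_conjugation (L F : Type*) [Field L] [Field F] [Algebra L F] [CharZero L]
    {y : F} (hy : ∀ a : F, ∃ b c : L, a = algebraMap L F b + algebraMap L F c * y)
    (hne : ¬ Function.Surjective (algebraMap L F)) :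
    ∃ τ : F ≃ₐ[L] F, (∀ a, τ (τ a) = a) ∧ (∀ a, τ a = a → a ∈ Set.range (algebraMap L F)) ∧
      ∃ u : F, u ≠ 0 ∧ τ u = -u := by
  have hspan : Submodule.span L ({1, y} : Set F) = ⊤ := by
    refine top_le_iff.1 fun a _ => ?_
    obtain ⟨b, c, rfl⟩ := hy a
    refine Submodule.mem_span_pair.2 ⟨b, c, ?_⟩
    rw [Algebra.smul_def, Algebra.smul_def, mul_one]
  have hfin : Module.Finite L F :=
    ⟨Submodule.fg_def.2 ⟨_, (Set.finite_singleton y).insert 1, hspan⟩⟩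
  have hle : Module.finrank L F ≤ 2 := by
    classical
    have := finrank_span_finset_le_card (R := L) ({1, y} : Finset F)
    rw [Finset.coe_pair, Set.finrank, hspan, finrank_top] at this
    exact this.trans Finset.card_le_two
  have h1 : Module.finrank L F ≠ 1 := by
    intro h
    apply hne
    have := Subalgebra.bot_eq_top_of_finrank_eq_one h
    intro a
    have ha : a ∈ (⊥ : Subalgebra L F) := by rw [this]; trivial
    exact Algebra.mem_bot.1 ha
  have h2 : Module.finrank L F = 2 := by
    have := Module.finrank_pos (R := L) (M := F)
    omega
  have : Algebra.IsQuadraticExtension L F := { finrank_eq_two' := h2 }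
  have : IsGalois L F := { }
  have hcard := IsGalois.card_aut_eq_finrank L F
  rw [h2] at hcard
  have : Finite (F ≃ₐ[L] F) := Nat.finite_of_card_ne_zero (by omega)
  have : Nontrivial (F ≃ₐ[L] F) := Finite.one_lt_card_iff_nontrivial.1 (by omega)
  obtain ⟨τ, hτ⟩ := exists_ne (1 : F ≃ₐ[L] F)
  have hsq : τ * τ = 1 := by
    have := pow_card_eq_one' (x := τ)
    rwa [hcard, pow_two] at this
  have hall : ∀ σ : F ≃ₐ[L] F, σ = 1 ∨ σ = τ := by
    rw [Nat.card_eq_two_iff' (1 : F ≃ₐ[L] F)] at hcard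
    obtain ⟨ρ, hρ, huniq⟩ := hcard
    intro σ
    by_cases hσ : σ = 1
    · exact Or.inl hσ
    · exact Or.inr ((huniq σ hσ).trans (huniq τ hτ).symm)
  have hinv : ∀ a, τ (τ a) = a := fun a => DFunLike.congr_fun hsq a
  refine ⟨τ, hinv, fun a ha => ?_, ?_⟩
  · refine IntermediateField.mem_bot.1 ((IsGalois.mem_bot_iff_fixed a).2 fun σ => ?_)
    rcases hall σ with rfl | rfl
    exacts [rfl, ha]
  · obtain ⟨a, ha⟩ : ∃ a, τ a ≠ a := by
      by_contra! h
      exact hτ (AlgEquiv.ext h)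
    exact ⟨a - τ a, sub_ne_zero.2 ha.symm, by rw [map_sub, hinv, neg_sub]⟩

/-! ### Repartitions and two estimates for the genus. -/

namespace Repartition

variable {K F ι : Type*} [Field K] [Field F] [Algebra K F] (M : ι → Submodule K F)

/-- The repartitions with respect to a family of subspaces. -/
def all : Submodule K (ι → F) where
  carrier := {r | {x | r x ∉ M x}.Finite}
  add_mem' := by
    intro r s hr hs
    refine (hr.union hs).subset fun x hx => ?_
    by_contra h
    simp only [Set.mem_union, Set.mem_ofPred_eq, not_or, not_not] at h
    exact hx (add_mem h.1 h.2)
  zero_mem' := by simp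
  smul_mem' := by
    intro c r hr
    exact Set.Finite.subset hr fun x hx h => hx (Submodule.smul_mem _ c h)

/-- The regular repartitions. -/
def regular : Submodule K (ι → F) where
  carrier := {r | ∀ x, r x ∈ M x}
  add_mem' := fun hr hs x => add_mem (hr x) (hs x)
  zero_mem' := fun _ => zero_mem _
  smul_mem' := fun c _ hr x => Submodule.smul_mem _ c (hr x)

variable (K F ι) in
/-- The constant repartitions. -/
def constant : Submodule K (ι → F) :=
  LinearMap.range (LinearMap.pi fun _ : ι => (LinearMap.id : F →ₗ[K] F))

/-- Repartitions modulo the regular and the constant ones. -/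
abbrev H1 := all M ⧸ (regular M ⊔ constant K F ι).comap (all M).subtype

variable {M}

lemma mem_constant (g : F) : (fun _ => g) ∈ constant K F ι := ⟨g, rfl⟩

lemma mem_sup_iff {r : ι → F} : r ∈ regular M ⊔ constant K F ι ↔ ∃ g : F, ∀ x, r x - g ∈ M x := by
  rw [Submodule.mem_sup]
  constructor
  · rintro ⟨s, hs, _, ⟨g, rfl⟩, rfl⟩
    exact ⟨g, fun x => by simpa using hs x⟩
  · rintro ⟨g, hg⟩
    exact ⟨fun x => r x - g, hg, _, mem_constant g, by ext; simp⟩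

/-- No inclusion of `B` in `A` is required, so it need not be known that constant repartitions have
only finitely many poles. -/
lemma finrank_le_card {V : Type*} [AddCommGroup V] [Module K V] (A B : Submodule K V)
    (s : Finset V) (hsA : ∀ v ∈ s, v ∈ A) (h : A ≤ B ⊔ Submodule.span K (s : Set V)) :
    Module.finrank K (A ⧸ B.comap A.subtype) ≤ s.card := by
  have hle : Submodule.span K (s : Set V) ≤ A := Submodule.span_le.2 hsA
  let g : Submodule.span K (s : Set V) →ₗ[K] A ⧸ B.comap A.subtype :=
    (B.comap A.subtype).mkQ ∘ₗ Submodule.inclusion hle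
  have hg : Function.Surjective g := by
    intro z
    obtain ⟨⟨a, ha⟩, rfl⟩ := Submodule.mkQ_surjective _ z
    obtain ⟨b, hb, c, hc, rfl⟩ := Submodule.mem_sup.1 (h ha)
    refine ⟨⟨c, hc⟩, ?_⟩
    change (B.comap A.subtype).mkQ _ = (B.comap A.subtype).mkQ _
    rw [← sub_eq_zero, ← map_sub, Submodule.mkQ_apply, Submodule.Quotient.mk_eq_zero]
    change c - (b + c) ∈ B
    simpa using hb
  have hfin : Module.Finite K (Submodule.span K (s : Set V)) := inferInstance
  exact (LinearMap.finrank_le_finrank_of_surjective hg).trans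
    (finrank_span_finset_le_card s)

end Repartition

open Repartition

/-- If a function has a single simple pole, then the genus is zero. -/
theorem finrank_H1_ne_one_of_simple_pole {K L ι : Type*} [Field K] [IsAlgClosed K] [Field L]
    [Algebra K L] (O : ι → ValuationSubring L) (M : ι → Submodule K L)
    (hM : ∀ i a, a ∈ M i ↔ a ∈ O i) {h : L} {e : ι}
    (hres : ∀ a ∈ O e, ∃ c : K, (O e).valuation (a - algebraMap K L c) < 1)
    (h1 : ∀ i, i ≠ e → h ∈ O i) (h2 : (O e).IsUniformizer h⁻¹)
    (hK : ∀ c : K, h ≠ algebraMap K L c) :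
    Module.finrank K (H1 M) ≠ 1 := by
  intro hone
  have hfin : Module.Finite K (H1 M) := Module.finite_of_finrank_pos (by omega)
  have hnt : Nontrivial (H1 M) := Module.nontrivial_of_finrank_pos (R := K) (by omega)
  -- Multiplication by `h` descends to a finite-dimensional nonzero `H1`, so it has an eigenvalue
  -- `c` there. But `h - c` can be inverted place by place, so `T - c` is surjective and hence
  -- injective, a contradiction.
  let m : (ι → L) →ₗ[K] (ι → L) := LinearMap.pi fun i => LinearMap.mulLeft K h ∘ₗ LinearMap.proj i
  have hm : ∀ r i, m r i = h * r i := fun _ _ => rfl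
  have hall : ∀ r ∈ all M, m r ∈ all M := by
    intro r hr
    refine (Set.Finite.union hr (Set.finite_singleton e)).subset fun i hi => ?_
    by_contra hcon
    simp only [Set.mem_union, Set.mem_ofPred_eq, not_or, not_not, Set.mem_singleton_iff] at hcon
    refine hi ?_
    rw [hM, hm]
    exact (O i).mul_mem _ _ (h1 i hcon.2) ((hM _ _).1 hcon.1)
  have hB : ∀ r ∈ regular M ⊔ constant K L ι, m r ∈ regular M ⊔ constant K L ι := by
    intro r hr
    obtain ⟨g, hg⟩ := mem_sup_iff.1 hr
    obtain ⟨c, hc⟩ := hres _ ((hM _ _).1 (hg e))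
    -- At the pole `e`, subtracting the residue `c` of `r e - g` leaves an element of the maximal
    -- ideal, which cancels the simple pole of `h`. The correction `c * h` is a constant
    -- repartition.
    refine mem_sup_iff.2 ⟨h * g + algebraMap K L c * h, fun i => ?_⟩
    rw [hM, hm]
    have heq : h * r i - (h * g + algebraMap K L c * h) = h * (r i - g - algebraMap K L c) := by ring
    rw [heq]
    by_cases hi : i = e
    · subst hi
      have hle := h2.2 _ hc
      rw [← ValuationSubring.valuation_le_one_iff, map_mul]
      refine (mul_le_mul_right hle _).trans ?_
      rw [map_inv₀]
      exact mul_inv_le_one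
    · refine (O i).mul_mem _ _ (h1 i hi) ((O i).sub_mem ((hM _ _).1 (hg i)) ?_)
      change algebraMap K L c ∈ O i
      rw [← hM, Algebra.algebraMap_eq_smul_one]
      exact (M i).smul_mem _ ((hM _ _).2 (O i).one_mem)
  let φ : all M →ₗ[K] all M := m.restrict hall
  let T : Module.End K (H1 M) := Submodule.mapQ _ _ φ fun r hr => hB _ hr
  obtain ⟨c, hc⟩ := Module.End.exists_eigenvalue T
  have hsurj : Function.Surjective (T - algebraMap K (Module.End K (H1 M)) c) := by
    classical
    intro z
    obtain ⟨⟨r, hr⟩, rfl⟩ := Submodule.mkQ_surjective _ z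
    have hne : h - algebraMap K L c ≠ 0 := sub_ne_zero.2 (hK c)
    -- Dividing only where `r` is not regular keeps `r'` a repartition; elsewhere `r` is zero modulo
    -- regular repartitions.
    let r' : ι → L := fun i => if r i ∈ M i then 0 else (h - algebraMap K L c)⁻¹ * r i
    have hr' : r' ∈ all M := by
      refine Set.Finite.subset hr fun i hi hmem => hi ?_
      simp only [r', if_pos hmem, zero_mem]
    refine ⟨Submodule.mkQ _ ⟨r', hr'⟩, ?_⟩
    set B := (regular M ⊔ constant K L ι).comap (all M).subtype
    rw [LinearMap.sub_apply, Module.algebraMap_end_apply]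
    change B.mkQ (φ ⟨r', hr'⟩) - c • B.mkQ (⟨r', hr'⟩ : all M) = B.mkQ ⟨r, hr⟩
    rw [← map_smul, ← map_sub, ← sub_eq_zero, ← map_sub, Submodule.mkQ_apply,
      Submodule.Quotient.mk_eq_zero]
    refine mem_sup_iff.2 ⟨0, fun i => ?_⟩
    change h * r' i - c • r' i - r i - 0 ∈ M i
    by_cases hmem : r i ∈ M i
    · simp only [r', if_pos hmem, mul_zero, smul_zero, sub_zero, zero_sub, neg_mem_iff, hmem]
    · simp only [r', if_neg hmem, Algebra.smul_def]
      have : h * ((h - algebraMap K L c)⁻¹ * r i) -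
          algebraMap K L c * ((h - algebraMap K L c)⁻¹ * r i) - r i - 0 = 0 := by
        field_simp; ring
      rw [this]; exact zero_mem _
  have hinj := (LinearMap.injective_iff_surjective (f := T - algebraMap K (Module.End K (H1 M)) c)).2 hsurj
  obtain ⟨v, hv⟩ := hc.exists_hasEigenvector
  refine hv.2 (hinj ?_)
  rw [map_zero, LinearMap.sub_apply, hv.apply_eq_smul, Module.algebraMap_end_apply, sub_self]

/-- The inequality of Castelnuovo and Severi for a double cover of a curve of genus one. -/
theorem finrank_H1_le_card_add_one {K L F ιE ιC : Type*} [Field K] [Field L] [Field F]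
    [Algebra K L] [Algebra K F] [Algebra L F] [IsScalarTower K L F]
    (OE : ιE → ValuationSubring L) (OC : ιC → ValuationSubring F)
    (ME : ιE → Submodule K L) (MC : ιC → Submodule K F)
    (hME : ∀ i a, a ∈ ME i ↔ a ∈ OE i) (hMC : ∀ i a, a ∈ MC i ↔ a ∈ OC i)
    (p : ιC → ιE) (hp : ∀ x, OE (p x) = (OC x).comap (algebraMap L F))
    (hdisc : ∀ x, OC x ≠ ⊤ → (OC x).IsDiscrete) (hinj : Function.Injective OC)
    (hfib : ∀ e, OE e ≠ ⊤ → {x | p x = e}.Finite) (htop : ∀ x, OE (p x) = ⊤ → OC x = ⊤)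
    {f : F} (hf : ∀ a : F, ∃ b c : L, a = algebraMap L F b + algebraMap L F c * f)
    (S : Finset ιE) (hS : S.Nonempty) (hStop : ∀ e ∈ S, OE e ≠ ⊤)
    (hres : ∀ e ∈ S, ∀ a ∈ OE e, ∃ c : K, (OE e).valuation (a - algebraMap K L c) < 1)
    (hf1 : ∀ x, p x ∉ S → f ∈ OC x)
    (hf2 : ∀ x, p x ∈ S → ∀ a : L, (OE (p x)).valuation a < 1 → algebraMap L F a * f ∈ OC x)
    (hE : Module.finrank K (H1 ME) = 1) : Module.finrank K (H1 MC) ≤ S.card + 1 := by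
  classical
  -- Genus one: a single class `ω` spans `H1` of the base.
  obtain ⟨ω, hω⟩ : ∃ ω : all ME, ∀ a : all ME, ∃ c : K,
      (a : ιE → L) - c • (ω : ιE → L) ∈ regular ME ⊔ constant K L ιE := by
    obtain ⟨v, -, hv⟩ := finrank_eq_one_iff'.1 hE
    obtain ⟨ω, rfl⟩ := Submodule.mkQ_surjective _ v
    refine ⟨ω, fun a => ?_⟩
    obtain ⟨c, hc⟩ := hv (Submodule.mkQ _ a)
    refine ⟨c, ?_⟩
    rw [← map_smul, eq_comm, ← sub_eq_zero, ← map_sub, Submodule.mkQ_apply,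
      Submodule.Quotient.mk_eq_zero] at hc
    exact hc
  have hKE : ∀ e (c : K), algebraMap K L c ∈ OE e := fun e c => by
    rw [← hME, Algebra.algebraMap_eq_smul_one]
    exact (ME e).smul_mem _ ((hME _ _).2 (OE e).one_mem)
  have hpmem : ∀ x a, a ∈ OE (p x) ↔ algebraMap L F a ∈ OC x := fun x a => by
    rw [hp, ValuationSubring.mem_comap]
  -- Along the decomposition `F = L + L f`, repartitions of the cover will be written as `P a + Q
  -- b`, where `P` is pullback and `Q` is pullback followed by multiplication by `f`.
  let P : (ιE → L) →ₗ[K] (ιC → F) :=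
    LinearMap.pi fun x => (IsScalarTower.toAlgHom K L F).toLinearMap ∘ₗ LinearMap.proj (p x)
  have hP : ∀ a x, P a x = algebraMap L F (a (p x)) := fun _ _ => rfl
  let Q : (ιE → L) →ₗ[K] (ιC → F) :=
    LinearMap.pi fun x => LinearMap.mulRight K f ∘ₗ (IsScalarTower.toAlgHom K L F).toLinearMap ∘ₗ
      LinearMap.proj (p x)
  have hQ : ∀ a x, Q a x = algebraMap L F (a (p x)) * f := fun _ _ => rfl
  have hpre : ∀ T : Set ιE, T.Finite → (∀ e ∈ T, OE e ≠ ⊤) → (p ⁻¹' T).Finite := by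
    intro T hT hTt
    have : p ⁻¹' T = ⋃ e ∈ T, {x | p x = e} := by ext; simp
    rw [this]
    exact hT.biUnion fun e he => hfib e (hTt e he)
  have hbad : ∀ a : all ME, ∀ e ∈ {e | (a : ιE → L) e ∉ ME e}, OE e ≠ ⊤ := by
    intro a e he h
    exact he ((hME _ _).2 (by rw [h]; trivial))
  have hPall : ∀ a : all ME, P a ∈ all MC := by
    intro a
    refine (hpre _ a.2 (hbad a)).subset fun x hx hmem => hx ?_
    rw [hMC, hP, ← hpmem, ← hME]
    exact hmem
  have hQall : ∀ a : all ME, Q a ∈ all MC := by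
    intro a
    refine ((hpre _ a.2 (hbad a)).union (hpre _ S.finite_toSet hStop)).subset fun x hx => ?_
    by_contra hcon
    simp only [Set.mem_union, Set.mem_preimage, Set.mem_ofPred_eq, not_or, not_not,
      SetLike.mem_coe] at hcon
    refine hx ?_
    rw [hMC, hQ]
    exact (OC x).mul_mem _ _ ((hpmem _ _).1 ((hME _ _).1 hcon.1)) (hf1 x hcon.2)
  have hδ : ∀ e : ιE, (Pi.single e 1 : ιE → L) ∈ all ME := by
    intro e
    refine (Set.finite_singleton e).subset fun i hi => ?_
    by_contra hne
    exact hi (by rw [Pi.single_eq_of_ne (by simpa using hne)]; exact zero_mem _)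
  obtain ⟨e0, he0⟩ := hS
  -- One generator for `P`, one for `Q`, and `S.card - 1` for the values at the poles of `f`. The
  -- point `e0` is spared because equal values at all points of `S` give the constant repartition `c
  -- * f`.
  let s : Finset (ιC → F) :=
    insert (P ω) (insert (Q ω) ((S.erase e0).image fun e => Q (Pi.single e 1)))
  have hcard : s.card ≤ S.card + 1 := by
    have h1 : s.card ≤ _ + 1 := Finset.card_insert_le _ _
    have h2 := Finset.card_insert_le (Q ω) ((S.erase e0).image fun e => Q (Pi.single e 1))
    have h3 := Finset.card_image_le (s := S.erase e0) (f := fun e => Q (Pi.single e 1))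
    rw [Finset.card_erase_of_mem he0] at h3
    have := Finset.card_pos.2 ⟨e0, he0⟩
    omega
  refine (finrank_le_card (all MC) (regular MC ⊔ constant K F ιC) s ?_ ?_).trans hcard
  · intro v hv
    simp only [s, Finset.mem_insert, Finset.mem_image] at hv
    rcases hv with rfl | rfl | ⟨e, -, rfl⟩
    exacts [hPall ω, hQall ω, hQall ⟨_, hδ e⟩]
  set N := (regular MC ⊔ constant K F ιC) ⊔ Submodule.span K (s : Set (ιC → F)) with hN
  have hreg : regular MC ≤ N := le_sup_left.trans le_sup_left
  have hcon : constant K F ιC ≤ N := le_sup_right.trans le_sup_left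
  have hspan : ∀ v ∈ s, v ∈ N := fun v hv =>
    Submodule.mem_sup_right (Submodule.subset_span hv)
  have hPN : ∀ a : all ME, P a ∈ N := by
    intro a
    obtain ⟨c, hc⟩ := hω a
    obtain ⟨g, hg⟩ := mem_sup_iff.1 hc
    have : P a = P (fun e => ((a : ιE → L) - c • (ω : ιE → L)) e - g) +
        (fun _ => algebraMap L F g) + c • P ω := by
      have h1 : P a = P (fun e => ((a : ιE → L) - c • (ω : ιE → L)) e - g) +
        P (fun _ => g) + c • P ω := by
        rw [← map_smul, ← map_add, ← map_add]; congr 1; ext; simp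
      rw [h1]; rfl
    rw [this]
    refine add_mem (add_mem (hreg fun x => ?_) (hcon (mem_constant _)))
      (N.smul_mem _ (hspan _ (by simp [s])))
    rw [hMC, hP, ← hpmem, ← hME]
    exact hg _
  have hQreg : ∀ a ∈ regular ME, Q a ∈ N := by
    intro a ha
    have : ∀ e, ∃ c : K, e ∈ S → (OE e).valuation (a e - algebraMap K L c) < 1 := by
      intro e
      by_cases he : e ∈ S
      · obtain ⟨c, hc⟩ := hres e he (a e) ((hME _ _).1 (ha e))
        exact ⟨c, fun _ => hc⟩
      · exact ⟨0, fun h => absurd h he⟩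
    choose c hc using this
    -- `b` has the values of `a` at the points of `S`. There `a - b` lies in the maximal ideal and
    -- absorbs the pole of `f`; elsewhere `a - b` and `f` are both regular.
    set b : ιE → L := (fun _ => algebraMap K L (c e0)) +
      ∑ e ∈ S.erase e0, (c e - c e0) • (Pi.single e 1 : ιE → L) with hb
    have hb1 : ∀ e ∈ S, b e = algebraMap K L (c e) := by
      intro e he
      simp only [hb, Pi.add_apply, Finset.sum_apply, Pi.smul_apply]
      by_cases hee : e = e0
      · subst hee
        rw [Finset.sum_eq_zero, add_zero]
        intro i hi
        rw [Pi.single_eq_of_ne (Finset.ne_of_mem_erase hi).symm, smul_zero]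
      · rw [Finset.sum_eq_single e]
        · rw [Pi.single_eq_same, ← Algebra.algebraMap_eq_smul_one, ← map_add]; congr 1; ring
        · intro i _ hi
          rw [Pi.single_eq_of_ne hi.symm, smul_zero]
        · intro h
          exact absurd (Finset.mem_erase.2 ⟨hee, he⟩) h
    have hb2 : ∀ e, e ∉ S → b e = algebraMap K L (c e0) := by
      intro e he
      simp only [hb, Pi.add_apply, Finset.sum_apply, Pi.smul_apply]
      rw [Finset.sum_eq_zero, add_zero]
      intro i hi
      rw [Pi.single_eq_of_ne, smul_zero]
      rintro rfl
      exact he (Finset.mem_of_mem_erase hi)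
    have hsplit : Q a = Q (a - b) + Q b := by rw [← map_add, sub_add_cancel]
    rw [hsplit]
    refine add_mem (hreg fun x => ?_) ?_
    · rw [hMC, hQ]
      by_cases hx : p x ∈ S
      · refine hf2 x hx _ ?_
        rw [Pi.sub_apply, hb1 _ hx]
        exact hc _ hx
      · refine (OC x).mul_mem _ _ ((hpmem _ _).1 ?_) (hf1 x hx)
        rw [Pi.sub_apply, hb2 _ hx]
        exact (OE _).sub_mem ((hME _ _).1 (ha _)) (hKE _ _)
    · rw [hb, map_add, map_sum]
      refine add_mem (hcon (mem_constant (algebraMap L F (algebraMap K L (c e0)) * f)))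
        (sum_mem fun e he => ?_)
      rw [map_smul]
      refine N.smul_mem _ (hspan _ ?_)
      simp only [s, Finset.mem_insert, Finset.mem_image]
      exact Or.inr (Or.inr ⟨e, he, rfl⟩)
  have hQN : ∀ a : all ME, Q a ∈ N := by
    intro a
    obtain ⟨c, hc⟩ := hω a
    obtain ⟨g, hg⟩ := mem_sup_iff.1 hc
    have : Q a = Q (fun e => ((a : ιE → L) - c • (ω : ιE → L)) e - g) +
        (fun _ => algebraMap L F g * f) + c • Q ω := by
      have h1 : Q a = Q (fun e => ((a : ιE → L) - c • (ω : ιE → L)) e - g) +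
        Q (fun _ => g) + c • Q ω := by
        rw [← map_smul, ← map_add, ← map_add]; congr 1; ext; simp
      rw [h1]; rfl
    rw [this]
    exact add_mem (add_mem (hQreg _ hg) (hcon (mem_constant _)))
      (N.smul_mem _ (hspan _ (by simp [s])))
  intro r hr
  -- Weak approximation replaces the components of `r` over `e` by one function, up to regular
  -- terms. The choice `0, 0` over good `e` makes `a` and `b` repartitions of the base.
  have happ : ∀ e, ∃ a b : L, ((∀ x, p x = e → r x ∈ MC x) → a = 0 ∧ b = 0) ∧
      ∀ x, p x = e → r x - (algebraMap L F a + algebraMap L F b * f) ∈ MC x := by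
    intro e
    by_cases hgood : ∀ x, p x = e → r x ∈ MC x
    · exact ⟨0, 0, fun _ => ⟨rfl, rfl⟩, fun x hx => by simpa using hgood x hx⟩
    · have het : OE e ≠ ⊤ := by
        rintro h
        refine hgood fun x hx => (hMC _ _).2 ?_
        rw [htop x (by rw [hx, h])]; trivial
      obtain ⟨t, ht⟩ := ValuationSubring.exists_approx ((hfib e het).toFinset.image OC) (by
          intro W hW
          simp only [Finset.mem_image, Set.Finite.mem_toFinset, Set.mem_ofPred_eq] at hW
          obtain ⟨x, hx, rfl⟩ := hW
          refine hdisc x fun h => het ?_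
          rw [← hx, hp, h]
          exact top_le_iff.1 fun _ _ => trivial) (Function.extend OC r 0)
      obtain ⟨a, b, rfl⟩ := hf t
      refine ⟨a, b, fun h => absurd h hgood, fun x hx => ?_⟩
      have := ht (OC x) (by simpa using ⟨x, hx, rfl⟩)
      rw [hinj.extend_apply] at this
      rw [hMC, ← neg_mem_iff, neg_sub, ← ValuationSubring.valuation_le_one_iff]
      exact this.le
  choose a b hab0 hab using happ
  have hzero : ∀ e, ¬ (a e = 0 ∧ b e = 0) → e ∈ p '' {x | r x ∉ MC x} := by
    intro e he
    by_contra hcon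
    refine he (hab0 e fun x hx => ?_)
    by_contra hxr
    exact hcon ⟨x, hxr, hx⟩
  have ha : a ∈ all ME := by
    refine (Set.Finite.image p hr).subset fun e he => hzero e fun h => he ?_
    rw [h.1]; exact zero_mem _
  have hb : b ∈ all ME := by
    refine (Set.Finite.image p hr).subset fun e he => hzero e fun h => he ?_
    rw [h.2]; exact zero_mem _
  have : r = (r - (P a + Q b)) + P a + Q b := by abel
  rw [this]
  exact add_mem (add_mem (hreg fun x => hab (p x) x rfl) (hPN ⟨a, ha⟩)) (hQN ⟨b, hb⟩)

/-! ### Double covers described by their places. -/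

/-- The family `O` consists of all the valuation rings of `F` that contain `K`, each once; those
that are not trivial are discrete and have residue field `K`. -/
structure IsPlaceFamily (K : Type*) {F ι : Type*} [Field K] [Field F] [Algebra K F]
    (O : ι → ValuationSubring F) : Prop where
  algebraMap_mem : ∀ i (c : K), algebraMap K F c ∈ O i
  injective : Function.Injective O
  surjective : ∀ V : ValuationSubring F, (∀ c : K, algebraMap K F c ∈ V) → ∃ i, O i = V
  discrete : ∀ i, O i ≠ ⊤ → (O i).IsDiscrete
  residue : ∀ i, O i ≠ ⊤ → ∀ a ∈ O i, ∃ c : K, (O i).valuation (a - algebraMap K F c) < 1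

/-- A double cover `p` of a curve of genus one with function field `L` by a curve with function
field `F`, described by the places of the two curves. -/
structure IsDoubleCover (K : Type*) {L F ιE ιC : Type*} [Field K] [Field L] [Field F]
    [Algebra K L] [Algebra K F] [Algebra L F]
    (OE : ιE → ValuationSubring L) (OC : ιC → ValuationSubring F) (p : ιC → ιE) : Prop where
  base : IsPlaceFamily K OE
  cover : IsPlaceFamily K OC
  comap_eq : ∀ x, OE (p x) = (OC x).comap (algebraMap L F)
  surjective : Function.Surjective p
  quadratic : ∃ y : F, ∀ a : F, ∃ b c : L, a = algebraMap L F b + algebraMap L F c * y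

namespace IsDoubleCover

variable {K L F ιE ιC : Type*} [Field K] [Field L] [Field F] [Algebra K L] [Algebra K F]
  [Algebra L F] {OE : ιE → ValuationSubring L}
  {OC : ιC → ValuationSubring F} {p : ιC → ιE} {ME : ιE → Submodule K L} {MC : ιC → Submodule K F}

lemma mem_iff (h : IsDoubleCover K OE OC p) (x : ιC) (a : L) :
    a ∈ OE (p x) ↔ algebraMap L F a ∈ OC x := by
  rw [h.comap_eq, ValuationSubring.mem_comap]

lemma apply_eq (h : IsDoubleCover K OE OC p) {x y : ιC}
    (hxy : (OC x).comap (algebraMap L F) = (OC y).comap (algebraMap L F)) : p x = p y :=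
  h.base.injective (by rw [h.comap_eq, h.comap_eq, hxy])

lemma ne_top (h : IsDoubleCover K OE OC p) {x : ιC} (hx : OE (p x) ≠ ⊤) : OC x ≠ ⊤ := by
  intro htop
  apply hx
  rw [h.comap_eq, htop]
  exact top_le_iff.1 fun _ _ => trivial

/-- If a function `f` on the cover has only simple poles, and the number of poles is at most the
genus minus two, then it comes from the base, and the cover has a conjugation. -/
theorem exists_conj [IsScalarTower K L F] [CharZero K] (h : IsDoubleCover K OE OC p)
    (hME : ∀ i a, a ∈ ME i ↔ a ∈ OE i) (hMC : ∀ i a, a ∈ MC i ↔ a ∈ OC i)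
    (hE : Module.finrank K (H1 ME) = 1) {f : F} {T : Finset ιC} (hT : T.Nonempty)
    (hTtop : ∀ x ∈ T, OC x ≠ ⊤) (hTf : ∀ x ∈ T, (OC x).IsUniformizer f⁻¹)
    (hf : ∀ x, x ∉ T → f ∈ OC x) (hC : T.card + 2 ≤ Module.finrank K (H1 MC)) :
    (∃ g : L, algebraMap L F g = f) ∧ ∃ t : ιC → ιC, (∀ x, p (t x) = p x) ∧
      (∀ x y, OC x ≠ ⊤ → p y = p x → y = x ∨ y = t x) ∧
      ∀ x (g : L), OC x ≠ ⊤ → (OC x).IsUniformizer (algebraMap L F g) → t x ≠ x := by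
  classical
  obtain ⟨y, hy⟩ := h.quadratic
  set S : Finset ιE := T.image p with hSd
  have hScard : S.card + 1 < Module.finrank K (H1 MC) := by
    have := Finset.card_image_le (s := T) (f := p)
    rw [← hSd] at this
    omega
  have hS : S.Nonempty := hT.image p
  have hStop (htop : ∀ x, OE (p x) = ⊤ → OC x = ⊤) : ∀ e ∈ S, OE e ≠ ⊤ := by
    intro e he
    obtain ⟨x, hx, rfl⟩ := Finset.mem_image.1 he
    exact fun h' => hTtop x hx (htop x h')
  -- The spanning condition `quadratic` allows degree one. Then the genus estimate applies with `f =
  -- 0` and contradicts `hC`.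
  by_cases hsurj : Function.Surjective (algebraMap L F)
  · exfalso
    have hinjp : Function.Injective p := by
      intro x x' hx
      apply h.cover.injective
      ext a
      obtain ⟨b, rfl⟩ := hsurj a
      rw [← h.mem_iff, ← h.mem_iff, hx]
    have htop : ∀ x, OE (p x) = ⊤ → OC x = ⊤ := by
      intro x hx
      refine top_le_iff.1 fun a _ => ?_
      obtain ⟨b, rfl⟩ := hsurj a
      rw [← h.mem_iff, hx]; trivial
    have := finrank_H1_le_card_add_one OE OC ME MC hME hMC p h.comap_eq h.cover.discrete
      h.cover.injective (fun e _ => Set.Subsingleton.finite fun x hx x' hx' =>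
        hinjp (hx.trans hx'.symm)) htop (f := 0)
      (fun a => by obtain ⟨b, rfl⟩ := hsurj a; exact ⟨b, 0, by simp⟩) S hS (hStop htop)
      (fun e he => h.base.residue e (hStop htop e he)) (fun x _ => (OC x).zero_mem)
      (fun x _ a _ => by rw [mul_zero]; exact (OC x).zero_mem) hE
    omega
  have : CharZero L := charZero_of_injective_algebraMap (algebraMap K L).injective
  obtain ⟨τ, hτ, hfix, u, hu, hτu⟩ := exists_quadratic_conjugation L F hy hsurj
  -- The conjugation acts on points because every valuation ring containing `K` belongs to the
  -- family.
  have hKτ : ∀ x, ∃ x', OC x' = (OC x).comap (τ : F →+* F) := fun x =>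
    h.cover.surjective _ fun c => by
      rw [ValuationSubring.mem_comap]
      change τ _ ∈ _
      rw [IsScalarTower.algebraMap_apply K L F, AlgEquiv.commutes,
        ← IsScalarTower.algebraMap_apply K L F]
      exact h.cover.algebraMap_mem x c
  choose t ht using hKτ
  have hcomap : ∀ V : ValuationSubring F,
      (V.comap (τ : F →+* F)).comap (algebraMap L F) = V.comap (algebraMap L F) := by
    intro V
    ext a
    rw [ValuationSubring.mem_comap, ValuationSubring.mem_comap, ValuationSubring.mem_comap]
    change τ _ ∈ _ ↔ _
    rw [AlgEquiv.commutes]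
  have htdisc : ∀ x, OC x ≠ ⊤ → ((OC x).comap (τ : F →+* F)).IsDiscrete := by
    intro x hx
    rw [← ht]
    refine h.cover.discrete _ fun h' => hx (top_le_iff.1 fun a _ => ?_)
    have : τ a ∈ OC (t x) := by rw [h']; trivial
    rw [ht, ValuationSubring.mem_comap] at this
    change τ (τ a) ∈ _ at this
    rwa [hτ] at this
  have hpt : ∀ x, p (t x) = p x := fun x => h.apply_eq (by rw [ht, hcomap])
  -- Each `a` in `F` satisfies `a = s - n / a`, with `s` and `n` its trace and norm; if `OC x`
  -- contains `L` and `a⁻¹`, it contains `a`.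
  have htop : ∀ x, OE (p x) = ⊤ → OC x = ⊤ := by
    intro x hx
    refine top_le_iff.1 fun a _ => ?_
    rcases (OC x).mem_or_inv_mem a with ha | ha
    · exact ha
    obtain ⟨s, hs⟩ := hfix (a + τ a) (by rw [map_add, hτ, add_comm])
    obtain ⟨n, hn⟩ := hfix (a * τ a) (by rw [map_mul, hτ, mul_comm])
    by_cases ha0 : a = 0
    · rw [ha0]; exact (OC x).zero_mem
    have hL : ∀ b : L, algebraMap L F b ∈ OC x := fun b => by rw [← h.mem_iff, hx]; trivial
    have : a = algebraMap L F s - algebraMap L F n * a⁻¹ := by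
      rw [hs, hn]; field_simp; ring
    rw [this]
    exact (OC x).sub_mem (hL s) ((OC x).mul_mem _ _ (hL n) ha)
  have hfibre : ∀ x y, OC x ≠ ⊤ → p y = p x → y = x ∨ y = t x := by
    intro x y hx hxy
    have hy' : OC y ≠ ⊤ := h.ne_top (by rw [hxy]; exact fun h' => hx (htop x h'))
    have hcc : (OC x).comap (algebraMap L F) = (OC y).comap (algebraMap L F) := by
      rw [← h.comap_eq, ← h.comap_eq, hxy]
    rcases ValuationSubring.eq_or_eq_comap_of_comap_eq τ hτ hfix (h.cover.discrete x hx)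
      (h.cover.discrete y hy') (htdisc x hx) (htdisc y hy') hcc with h' | h'
    · exact Or.inl (h.cover.injective h')
    · exact Or.inr (h.cover.injective (h'.trans (ht x).symm))
  refine ⟨?_, t, hpt, hfibre, ?_⟩
  · by_contra! hnot
    -- A function outside `L` can replace `y` as generator, and the genus estimate then exceeds what
    -- `hC` allows.
    have hf' : ∀ a : F, ∃ b c : L, a = algebraMap L F b + algebraMap L F c * f := by
      obtain ⟨b, c, hbc⟩ := hy f
      have hc : c ≠ 0 := by
        rintro rfl
        exact hnot b (by rw [hbc, map_zero, zero_mul, add_zero])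
      have hc' : algebraMap L F c ≠ 0 := by simpa using hc
      intro a
      obtain ⟨b', c', rfl⟩ := hy a
      refine ⟨b' - c' * b / c, c' / c, ?_⟩
      rw [hbc, map_sub, map_div₀, map_div₀, map_mul]
      field_simp
      ring
    have := finrank_H1_le_card_add_one OE OC ME MC hME hMC p h.comap_eq h.cover.discrete
      h.cover.injective (fun e he => by
        obtain ⟨x, rfl⟩ := h.surjective e
        refine (Set.toFinite {x, t x}).subset fun y hy => ?_
        exact hfibre x y (h.ne_top he) hy) htop hf' S hS (hStop htop)
      (fun e he => h.base.residue e (hStop htop e he))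
      (fun x hx => hf x fun hxT => hx (Finset.mem_image_of_mem p hxT))
      (fun x _ a ha => by
        by_cases hxT : x ∈ T
        · rw [h.comap_eq, ValuationSubring.valuation_comap_lt_one_iff] at ha
          have := (hTf x hxT).2 _ ha
          rw [← ValuationSubring.valuation_le_one_iff, map_mul]
          refine (mul_le_mul_left this _).trans ?_
          rw [map_inv₀]
          exact inv_mul_le_one
        · exact (OC x).mul_mem _ _ ((h.mem_iff x a).1
            ((ValuationSubring.valuation_le_one_iff _ _).1 ha.le)) (hf x hxT)) hE
    omega
  · intro x g hx hg hfixed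
    refine ValuationSubring.comap_ne_of_isUniformizer (K := K) τ hu hτu (h.cover.discrete x hx)
      (h.cover.algebraMap_mem x) (h.cover.residue x hx) hg ?_
    rw [← ht, hfixed]

/-- A function with simple poles, all of them in one fibre, does not come from a base of genus
one. -/
theorem false_of_simple_poles_in_fibre [IsAlgClosed K] (h : IsDoubleCover K OE OC p)
    (hME : ∀ i a, a ∈ ME i ↔ a ∈ OE i) (hE : Module.finrank K (H1 ME) = 1) {g : L} {x : ιC}
    (hx : OC x ≠ ⊤) (hxe : OE (p x) ≠ ⊤) (hg : (OC x).IsUniformizer (algebraMap L F g)⁻¹)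
    (hpole : ∀ x', p x' ≠ p x → algebraMap L F g ∈ OC x') : False := by
  -- A pole that is simple on the cover is simple below: if `a` vanishes at `p x`, its pullback
  -- vanishes at `x`, so `a * g` is regular.
  have hunif : (OE (p x)).IsUniformizer g⁻¹ := by
    have hg0 := ((h.cover.discrete x hx).exists_zpow hg).1
    refine ⟨?_, fun a ha => ?_⟩
    · rw [h.comap_eq, ValuationSubring.valuation_comap_lt_one_iff, map_inv₀]
      exact hg.1
    · rw [h.comap_eq, ValuationSubring.valuation_comap_lt_one_iff] at ha
      have := hg.2 _ ha
      have hne : (OC x).valuation (algebraMap L F g) ≠ 0 := by simpa using hg0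
      have hmem : a * g ∈ OE (p x) := by
        rw [h.mem_iff, ← ValuationSubring.valuation_le_one_iff, map_mul, map_mul]
        refine (mul_le_mul_left this _).trans ?_
        rw [map_inv₀]
        exact inv_mul_le_one
      rw [← ValuationSubring.valuation_le_one_iff, map_mul] at hmem
      have hg1 : (OE (p x)).valuation g ≠ 0 := by simpa using hg0
      rw [map_inv₀]
      exact (le_mul_inv_iff₀ (zero_lt_iff.2 hg1)).2 hmem |>.trans (by rw [one_mul])
  refine finrank_H1_ne_one_of_simple_pole OE ME hME (h.base.residue _ hxe) ?_ hunif ?_ hE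
  · intro e he
    obtain ⟨x', rfl⟩ := h.surjective e
    exact (h.mem_iff _ _).2 (hpole x' he)
  · rintro c rfl
    have := hunif.1
    have hc : c ≠ 0 := by simpa using ((h.cover.discrete x hx).exists_zpow hg).1
    rw [map_inv₀, inv_lt_one₀ (zero_lt_iff.2 (by simpa using hc))] at this
    exact absurd ((ValuationSubring.valuation_le_one_iff _ _).2 (h.base.algebraMap_mem _ c))
      (not_le.2 this)

end IsDoubleCover

/-! ### Differentials and regularity at a rational point. -/

open IsLocalRing in
/-- The derivation `r ↦ r - r(x)` into the cotangent space of a rational point. -/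
def IsLocalRing.cotangentDerivation (A R : Type*) [CommRing A] [CommRing R] [IsLocalRing R]
    [Algebra A R] (h : Function.Bijective (algebraMap A (ResidueField R))) :
    Derivation A R (CotangentSpace R) :=
  let ret : R →ₐ[A] R := (Algebra.ofId A R).comp
    ((AlgEquiv.ofBijective (Algebra.ofId A (ResidueField R)) h).symm.toAlgHom.comp
      (IsScalarTower.toAlgHom A R (ResidueField R)))
  have hret : ∀ r, r - ret r ∈ maximalIdeal R := fun r => by
    rw [← residue_eq_zero_iff, map_sub, sub_eq_zero]
    exact ((AlgEquiv.ofBijective (Algebra.ofId A (ResidueField R)) h).apply_symm_apply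
      (residue R r)).symm
  { toFun := fun r => (maximalIdeal R).toCotangent ⟨r - ret r, hret r⟩
    map_add' := fun r s => by
      rw [← map_add]
      congr 1
      ext
      simp only [map_add, Submodule.coe_add]
      ring
    map_smul' := fun a r => by
      rw [RingHom.id_apply, ← algebraMap_smul R a, ← algebraMap_smul R a, ← map_smul]
      congr 1
      ext
      simp only [smul_eq_mul, map_mul, AlgHom.commutes, Submodule.coe_smul]
      ring
    map_one_eq_zero' := by
      rw [LinearMap.coe_mk, AddHom.coe_mk]
      exact (Ideal.toCotangent_eq_zero _ _).2 (by simp)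
    leibniz' := fun r s => by
      rw [LinearMap.coe_mk, AddHom.coe_mk, ← map_smul, ← map_smul, ← map_add,
        Ideal.toCotangent_eq]
      have : r * s - ret (r * s) - (r * (s - ret s) + s * (r - ret r)) =
          -((r - ret r) * (s - ret s)) := by
        rw [map_mul]; ring
      change r * s - ret (r * s) - (r * (s - ret s) + s * (r - ret r)) ∈ _
      rw [this, pow_two]
      exact neg_mem (Ideal.mul_mem_mul (hret r) (hret s)) }

open IsLocalRing in
lemma IsLocalRing.cotangentDerivation_apply (A R : Type*) [CommRing A] [CommRing R] [IsLocalRing R]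
    [Algebra A R] (h : Function.Bijective (algebraMap A (ResidueField R))) (m : maximalIdeal R) :
    cotangentDerivation A R h m = (maximalIdeal R).toCotangent m := by
  have h0 : residue R (m : R) = 0 := (residue_eq_zero_iff _).2 m.2
  refine congrArg _ (Subtype.ext ?_)
  change (m : R) - algebraMap A R ((AlgEquiv.ofBijective (Algebra.ofId A (ResidueField R)) h).symm
    (residue R (m : R))) = m
  rw [h0, map_zero, map_zero, sub_zero]

open IsLocalRing in
/-- A Noetherian local domain with a rational residue field and differentials of rank one is a
discrete valuation ring. -/
theorem IsLocalRing.isDiscreteValuationRing_of_kaehler (A R : Type*) [CommRing A] [CommRing R]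
    [IsDomain R] [IsLocalRing R] [IsNoetherianRing R] [Algebra A R]
    (h : Function.Bijective (algebraMap A (ResidueField R))) [Module.Free R Ω[R⁄A]]
    (h1 : Module.finrank R Ω[R⁄A] = 1) : IsDiscreteValuationRing R := by
  -- The cotangent space is a quotient of the differentials, so its dimension is at most one.
  let φ := (cotangentDerivation A R h).liftKaehlerDifferential
  have hφ : Function.Surjective φ := by
    intro z
    obtain ⟨m, rfl⟩ := (maximalIdeal R).toCotangent_surjective z
    exact ⟨KaehlerDifferential.D A R m, by
      rw [Derivation.liftKaehlerDifferential_comp_D, cotangentDerivation_apply]⟩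
  obtain ⟨ω, -, hω⟩ := finrank_eq_one_iff'.1 h1
  have hle : Module.finrank (ResidueField R) (CotangentSpace R) ≤ 1 := by
    refine finrank_le_one (φ ω) fun z => ?_
    obtain ⟨η, rfl⟩ := hφ z
    obtain ⟨c, rfl⟩ := hω η
    exact ⟨residue R c, by rw [map_smul]; rfl⟩
  -- A field with rational residue field is the image of `A` and has no differentials, against rank
  -- one.
  have hnf : ¬ IsField R := by
    intro hf
    have hsurj : Function.Surjective (algebraMap A R) := by
      intro r
      obtain ⟨a, ha⟩ := h.2 (residue R r)
      refine ⟨a, ?_⟩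
      let := hf.toField
      exact (residue R).injective ha
    have := KaehlerDifferential.subsingleton_of_surjective A R hsurj
    have h0 := Module.finrank_zero_of_subsingleton (R := R) (M := Ω[R⁄A])
    omega
  exact ((IsDiscreteValuationRing.TFAE R hnf).out 0 4).2
    (finrank_cotangentSpace_le_one_iff.1 hle)

/-! ### Local rings at the closed points of a curve. -/

namespace Curve

variable {K : Type u} [Field K] (X : Curve K)

/-- The constants in the local ring at a point. -/
def stalkConstants (x : X.toScheme) : K →+* X.toScheme.presheaf.stalk x :=
  (X.toScheme.presheaf.germ ⊤ x (Set.mem_univ x)).hom.comp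
    (X.str.appTop.hom.comp (Scheme.ΓSpecIso (.of K)).inv.hom)

lemma algebraMap_stalkConstants (x : X.toScheme) (c : K) :
    algebraMap (X.toScheme.presheaf.stalk x) X.FunctionField (X.stalkConstants x c) =
      algebraMap K X.FunctionField c := by
  have : Nonempty (⊤ : X.toScheme.Opens) := ⟨⟨x, Set.mem_univ x⟩⟩
  exact Scheme.algebraMap_germ_eq_germToFunctionField X.toScheme
      (U := ⊤) (x := x) (Set.mem_univ x) _

lemma str_eq : X.str = X.toScheme.toSpecΓ ≫ Spec.map X.str.appTop ≫
    Spec.map (Scheme.ΓSpecIso (.of K)).inv := by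
  rw [← Category.assoc, ← Scheme.toSpecΓ_naturality, Category.assoc, ← SpecMap_ΓSpecIso_hom,
    ← Spec.map_comp, Iso.inv_hom_id, Spec.map_id, Category.comp_id]

lemma fromSpecStalk_str (x : X.toScheme) :
    X.toScheme.fromSpecStalk x ≫ X.str = Spec.map (CommRingCat.ofHom (X.stalkConstants x)) := by
  conv_lhs => rw [X.str_eq]
  rw [Scheme.fromSpecStalk_toSpecΓ_assoc, ← Spec.map_comp, ← Spec.map_comp]
  rfl

lemma residue_stalkConstants_bijective [IsAlgClosed K] (x : X.toScheme) (hx : IsClosed {x}) :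
    Function.Bijective ((X.toScheme.residue x).hom.comp (X.stalkConstants x)) := by
  have h1 : CommRingCat.ofHom ((X.toScheme.residue x).hom.comp (X.stalkConstants x)) =
      (residueFieldIsoBase X.str x hx).inv := by
    apply Spec.map_injective
    rw [SpecMap_residueFieldIsoBase_inv, Scheme.fromSpecResidueField, Category.assoc,
      fromSpecStalk_str, ← Spec.map_comp]
    rfl
  have h2 := (residueFieldIsoBase X.str x hx).symm.commRingCatIsoToRingEquiv.bijective
  have h3 : ((X.toScheme.residue x).hom.comp (X.stalkConstants x)) =
      (residueFieldIsoBase X.str x hx).inv.hom := congrArg CommRingCat.Hom.hom h1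
  rw [h3]
  exact h2

/-- A smooth chart has free differentials of rank one. They localize to the stalk, whose residue
field is `K` because `K` is algebraically closed, so the criterion through differentials applies. -/
lemma isDiscreteValuationRing_stalk [IsAlgClosed K] (x : X.toScheme) (hx : IsClosed {x}) :
    IsDiscreteValuationRing (X.toScheme.presheaf.stalk x) := by
  obtain ⟨U, hU, V, hV, hxV, e, hstd⟩ :=
    X.smooth.exists_isStandardSmoothOfRelativeDimension x
  -- The spectrum of a field has only one point.
  obtain rfl : U = ⊤ := by
    refine top_le_iff.1 fun y _ => ?_
    rw [Subsingleton.elim y (X.str x)]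
    exact e hxV
  let R := X.toScheme.presheaf.stalk x
  algebraize [(X.str.appLE ⊤ V e).hom]
  let : Algebra Γ(X.toScheme, V) R := (X.toScheme.presheaf.germ V x hxV).hom.toAlgebra
  let : Algebra Γ(Spec (.of K), ⊤) R :=
    ((X.toScheme.presheaf.germ V x hxV).hom.comp (X.str.appLE ⊤ V e).hom).toAlgebra
  have : IsScalarTower Γ(Spec (.of K), ⊤) Γ(X.toScheme, V) R := .of_algebraMap_eq' rfl
  have hloc : IsLocalization.AtPrime R (hV.primeIdealOf ⟨x, hxV⟩).asIdeal :=
    hV.isLocalization_stalk ⟨x, hxV⟩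
  have : Algebra.FormallyEtale Γ(X.toScheme, V) R :=
    Algebra.FormallyEtale.of_isLocalization (hV.primeIdealOf ⟨x, hxV⟩).asIdeal.primeCompl
  have : Nonempty V := ⟨⟨x, hxV⟩⟩
  have : Algebra.IsStandardSmooth Γ(Spec (.of K), ⊤) Γ(X.toScheme, V) :=
    Algebra.IsStandardSmoothOfRelativeDimension.isStandardSmooth 1
  let eΩ := KaehlerDifferential.tensorKaehlerEquivOfFormallyEtale Γ(Spec (.of K), ⊤) Γ(X.toScheme, V) R
  have hfree : Module.Free R Ω[R⁄Γ(Spec (.of K), ⊤)] := Module.Free.of_equiv eΩ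
  have hrank : Module.finrank R Ω[R⁄Γ(Spec (.of K), ⊤)] = 1 := by
    rw [← eΩ.finrank_eq, Module.finrank_baseChange, Module.finrank,
      Algebra.IsStandardSmoothOfRelativeDimension.rank_kaehlerDifferential 1]
    simp
  refine IsLocalRing.isDiscreteValuationRing_of_kaehler Γ(Spec (.of K), ⊤) R ?_ hrank
  have h1 := X.residue_stalkConstants_bijective x hx
  have h2 : ∀ z : Γ(Spec (.of K), ⊤), X.toScheme.presheaf.germ ⊤ x (Set.mem_univ x)
      (X.str.appTop.hom z) = X.toScheme.presheaf.germ V x hxV ((X.str.appLE ⊤ V e).hom z) := by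
    intro z
    rw [Scheme.Hom.appLE, CommRingCat.hom_comp, RingHom.comp_apply]
    exact (X.toScheme.presheaf.germ_res_apply (homOfLE e) x hxV _).symm
  have h3 : Function.Bijective (Scheme.ΓSpecIso (.of K)).inv.hom :=
    (Scheme.ΓSpecIso (.of K)).symm.commRingCatIsoToRingEquiv.bijective
  have h4 : Function.Bijective ((algebraMap Γ(Spec (.of K), ⊤) (IsLocalRing.ResidueField R)) ∘
      (Scheme.ΓSpecIso (.of K)).inv.hom) := by
    have heq : (algebraMap Γ(Spec (.of K), ⊤) (IsLocalRing.ResidueField R)) ∘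
        (Scheme.ΓSpecIso (.of K)).inv.hom =
        (fun c => IsLocalRing.residue R (X.stalkConstants x c)) := by
      funext c
      exact congrArg (IsLocalRing.residue R) (h2 ((Scheme.ΓSpecIso (.of K)).inv.hom c)).symm
    rw [heq]
    exact h1
  exact (Function.Bijective.of_comp_iff _ h3).1 h4

end Curve

/-! ### The points of a curve as the valuation rings of its function field. -/

namespace Curve

variable {K : Type u} [Field K] (X : Curve K)

instance : CompactSpace X.toScheme := by
  have : QuasiCompact X.str := inferInstance
  exact QuasiCompact.compactSpace_of_compactSpace X.str

lemma exists_closed_specialization (x : X.toScheme) : ∃ y, x ⤳ y ∧ IsClosed {y} := by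
  obtain ⟨y, hy, hc⟩ := IsClosed.exists_closed_singleton (isClosed_closure (s := {x}))
    ⟨x, subset_closure rfl⟩
  exact ⟨y, specializes_iff_mem_closure.2 hy, hc⟩

lemma algebraMap_stalkSpecializes {x y : X.toScheme} (h : x ⤳ y)
    (a : X.toScheme.presheaf.stalk y) :
    algebraMap _ X.FunctionField ((X.toScheme.presheaf.stalkSpecializes h).hom a) =
      algebraMap _ X.FunctionField a :=
  X.toScheme.presheaf.stalkSpecializes_comp_apply _ h a

/-- Any point, the generic one included, specializes to a closed point, whose discrete valuation
ring is contained in the local ring at `x`. -/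
lemma mem_range_or_inv_mem_range [IsAlgClosed K] (x : X.toScheme) (a : X.FunctionField) :
    a ∈ (algebraMap (X.toScheme.presheaf.stalk x) X.FunctionField).range ∨
      a⁻¹ ∈ (algebraMap (X.toScheme.presheaf.stalk x) X.FunctionField).range := by
  obtain ⟨y, hxy, hy⟩ := X.exists_closed_specialization x
  have := X.isDiscreteValuationRing_stalk y hy
  have hle : ∀ b : X.FunctionField, IsLocalization.IsInteger (X.toScheme.presheaf.stalk y) b →
      b ∈ (algebraMap (X.toScheme.presheaf.stalk x) X.FunctionField).range := by
    rintro b ⟨c, rfl⟩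
    exact ⟨_, X.algebraMap_stalkSpecializes hxy c⟩
  exact (ValuationRing.isInteger_or_isInteger (X.toScheme.presheaf.stalk y) a).imp (hle _) (hle _)

/-- The generic point of a curve, as a morphism from the spectrum of the function field. -/
def generic : Spec (.of X.FunctionField) ⟶ X.toScheme :=
  X.toScheme.fromSpecStalk (genericPoint X.toScheme)

lemma generic_str :
    X.generic ≫ X.str = Spec.map (CommRingCat.ofHom (algebraMap K X.FunctionField)) :=
  X.fromSpecStalk_str _

lemma SpecMap_algebraMap_fromSpecStalk (x : X.toScheme) :
    Spec.map (CommRingCat.ofHom (algebraMap (X.toScheme.presheaf.stalk x) X.FunctionField)) ≫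
      X.toScheme.fromSpecStalk x = X.generic :=
  Scheme.SpecMap_stalkSpecializes_fromSpecStalk (genericPoint_specializes x)

/-- The constants in a valuation ring. -/
def constantsToSubring {V : ValuationSubring X.FunctionField}
    (hV : ∀ c : K, algebraMap K X.FunctionField c ∈ V) : K →+* V :=
  (algebraMap K X.FunctionField).codRestrict V.toSubring hV

lemma valuativeCommSq {V : ValuationSubring X.FunctionField}
    (hV : ∀ c : K, algebraMap K X.FunctionField c ∈ V) :
    CommSq X.generic
      (Spec.map (CommRingCat.ofHom (algebraMap V X.FunctionField))) X.str
      (Spec.map (CommRingCat.ofHom (X.constantsToSubring hV))) := by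
  refine ⟨?_⟩
  rw [generic_str, ← Spec.map_comp, ← CommRingCat.ofHom_comp]
  rfl

variable [IsAlgClosed K]

/-- The local ring at a point of a curve, as a valuation ring of the function field. -/
def valuationSubring (x : X.toScheme) : ValuationSubring X.FunctionField :=
  ValuationSubring.ofSubring
    (algebraMap (X.toScheme.presheaf.stalk x) X.FunctionField).range
    (X.mem_range_or_inv_mem_range x)

lemma mem_localRing_iff (x : X.toScheme) (a : X.FunctionField) :
    a ∈ X.localRing x ↔ a ∈ X.valuationSubring x := Iff.rfl

lemma algebraMap_mem_valuationSubring (x : X.toScheme) (c : K) :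
    algebraMap K X.FunctionField c ∈ X.valuationSubring x :=
  ⟨X.stalkConstants x c, X.algebraMap_stalkConstants x c⟩

lemma valuation_algebraMap_lt_one_iff {x : X.toScheme} (b : X.toScheme.presheaf.stalk x) :
    (X.valuationSubring x).valuation (algebraMap _ X.FunctionField b) < 1 ↔
      b ∈ IsLocalRing.maximalIdeal (X.toScheme.presheaf.stalk x) := by
  rw [← ValuationSubring.mem_nonunits_iff, ValuationSubring.mem_nonunits_iff_or,
    IsLocalRing.mem_maximalIdeal, mem_nonunits_iff]
  have hinj := IsFractionRing.injective (X.toScheme.presheaf.stalk x) X.FunctionField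
  constructor
  · rintro h hb
    rcases h with h | h
    · rw [map_eq_zero_iff _ hinj] at h
      exact hb.ne_zero h
    · obtain ⟨u, rfl⟩ := hb
      exact h ⟨↑u⁻¹, eq_inv_of_mul_eq_one_left (by rw [← map_mul, Units.inv_mul, map_one])⟩
  · intro hb
    by_contra! hcon
    obtain ⟨h0, c, hc⟩ := hcon
    refine hb (IsUnit.of_mul_eq_one c (hinj ?_))
    rw [map_mul, hc, mul_inv_cancel₀ h0, map_one]

lemma valuation_algebraMap_unit {x : X.toScheme} {b : X.toScheme.presheaf.stalk x}
    (hb : IsUnit b) : (X.valuationSubring x).valuation (algebraMap _ X.FunctionField b) = 1 := by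
  refine le_antisymm ((ValuationSubring.valuation_le_one_iff _ _).2 ⟨b, rfl⟩) (not_lt.1 fun h => ?_)
  rw [valuation_algebraMap_lt_one_iff] at h
  exact h hb

lemma valuationSubring_le_of_specializes {x y : X.toScheme} (h : x ⤳ y) :
    X.valuationSubring y ≤ X.valuationSubring x := by
  rintro _ ⟨c, rfl⟩
  exact ⟨_, X.algebraMap_stalkSpecializes h c⟩

lemma exists_residue {x : X.toScheme} (hx : IsClosed {x}) {a : X.FunctionField}
    (ha : a ∈ X.valuationSubring x) :
    ∃ c : K, (X.valuationSubring x).valuation (a - algebraMap K X.FunctionField c) < 1 := by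
  obtain ⟨b, rfl⟩ := ha
  obtain ⟨c, hc⟩ := (X.residue_stalkConstants_bijective x hx).2 (X.toScheme.residue x b)
  refine ⟨c, ?_⟩
  rw [← X.algebraMap_stalkConstants x, ← map_sub, valuation_algebraMap_lt_one_iff,
    ← IsLocalRing.residue_eq_zero_iff, map_sub, sub_eq_zero]
  exact hc.symm

lemma isUniformizer_algebraMap {x : X.toScheme} (hx : IsClosed {x})
    {b : X.toScheme.presheaf.stalk x} (hb : Irreducible b) :
    (X.valuationSubring x).IsUniformizer (algebraMap _ X.FunctionField b) := by
  have := X.isDiscreteValuationRing_stalk x hx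
  have hmax := (IsDiscreteValuationRing.irreducible_iff_uniformizer b).1 hb
  refine ⟨(X.valuation_algebraMap_lt_one_iff b).2 (by rw [hmax]; exact Ideal.mem_span_singleton_self b),
    fun a ha => ?_⟩
  obtain ⟨c, rfl⟩ := (ValuationSubring.valuation_le_one_iff _ _).1 ha.le
  rw [valuation_algebraMap_lt_one_iff, hmax, Ideal.mem_span_singleton] at ha
  obtain ⟨d, rfl⟩ := ha
  rw [map_mul, map_mul]
  exact mul_le_of_le_one_right' ((ValuationSubring.valuation_le_one_iff _ _).2 ⟨d, rfl⟩)

lemma isDiscrete_valuationSubring {x : X.toScheme} (hx : IsClosed {x}) :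
    (X.valuationSubring x).IsDiscrete := by
  have := X.isDiscreteValuationRing_stalk x hx
  obtain ⟨ϖ, hϖ⟩ := IsDiscreteValuationRing.exists_irreducible (X.toScheme.presheaf.stalk x)
  have hinj := IsFractionRing.injective (X.toScheme.presheaf.stalk x) X.FunctionField
  have hϖ0 : algebraMap _ X.FunctionField ϖ ≠ 0 := (map_ne_zero_iff _ hinj).2 hϖ.ne_zero
  refine ⟨_, hϖ0, (X.isUniformizer_algebraMap hx hϖ).1, fun a ha => ?_⟩
  have key : ∀ b : X.toScheme.presheaf.stalk x, b ≠ 0 → ∃ n : ℕ,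
      (X.valuationSubring x).valuation (algebraMap _ X.FunctionField b) =
        (X.valuationSubring x).valuation (algebraMap _ X.FunctionField ϖ) ^ n := by
    intro b hb
    obtain ⟨n, u, rfl⟩ := IsDiscreteValuationRing.eq_unit_mul_pow_irreducible hb hϖ
    exact ⟨n, by rw [map_mul, map_mul, X.valuation_algebraMap_unit u.isUnit, one_mul, map_pow,
      map_pow]⟩
  obtain ⟨b, c, hc, rfl⟩ := IsFractionRing.div_surjective (X.toScheme.presheaf.stalk x) a
  obtain ⟨n, hn⟩ := key b (by rintro rfl; simp at ha)
  obtain ⟨m, hm⟩ := key c (nonZeroDivisors.ne_zero hc)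
  have hv : (X.valuationSubring x).valuation (algebraMap _ X.FunctionField ϖ) ≠ 0 := by
    simpa using hϖ0
  refine ⟨n - m, ?_⟩
  rw [map_div₀, hn, hm, zpow_sub₀ hv, zpow_natCast, zpow_natCast]

/-- The inclusion of a local ring in a valuation ring that contains it. -/
def stalkToSubring {x : X.toScheme} {V : ValuationSubring X.FunctionField}
    (h : X.valuationSubring x ≤ V) : X.toScheme.presheaf.stalk x →+* V :=
  (algebraMap (X.toScheme.presheaf.stalk x) X.FunctionField).codRestrict V.toSubring
    fun b => h ⟨b, rfl⟩

/-- Uniqueness in the valuative criterion: each point with local ring `V` is the image of the closed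
point under a lift `Spec V → X`, and a separated curve admits only one such lift. -/
lemma injective_valuationSubring : Function.Injective X.valuationSubring := by
  intro x y hxy
  have hV := X.algebraMap_mem_valuationSubring y
  have huniq := IsSeparated.valuativeCriterion X.str
    { R := X.valuationSubring y, K := X.FunctionField, commSq := X.valuativeCommSq hV, .. }
  have key : ∀ z (hz : X.valuationSubring z = X.valuationSubring y),
      ∃ l : (X.valuativeCommSq hV).LiftStruct,
        l.l (IsLocalRing.closedPoint (X.valuationSubring y)) = z := by
    intro z hz
    let φ := X.stalkToSubring hz.le
    have hφ : IsLocalHom φ := by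
      refine ⟨fun b hb => ?_⟩
      by_contra hnu
      have h1 := (X.valuation_algebraMap_lt_one_iff b).2 hnu
      rw [hz] at h1
      have h2 := (ValuationSubring.valuation_eq_one_iff _ (φ b)).1 hb
      exact h1.ne h2
    refine ⟨⟨Spec.map (CommRingCat.ofHom φ) ≫ X.toScheme.fromSpecStalk z, ?_, ?_⟩, ?_⟩
    · rw [← Category.assoc, ← Spec.map_comp, ← CommRingCat.ofHom_comp]
      exact X.SpecMap_algebraMap_fromSpecStalk z
    · rw [Category.assoc, fromSpecStalk_str, ← Spec.map_comp, ← CommRingCat.ofHom_comp]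
      congr 2
      ext c
      exact X.algebraMap_stalkConstants z c
    · have h3 : Spec.map (CommRingCat.ofHom φ) (IsLocalRing.closedPoint (X.valuationSubring y)) =
          IsLocalRing.closedPoint (X.toScheme.presheaf.stalk z) :=
        IsLocalRing.comap_closedPoint φ
      change X.toScheme.fromSpecStalk z (Spec.map (CommRingCat.ofHom φ) (IsLocalRing.closedPoint _)) = z
      rw [h3, Scheme.fromSpecStalk_closedPoint]
  obtain ⟨l, hl⟩ := key x hxy
  obtain ⟨l', hl'⟩ := key y rfl
  have : l = l' := huniq.elim _ _
  exact hl.symm.trans ((congrArg (fun l => l.l (IsLocalRing.closedPoint _)) this).trans hl')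

/-- Existence in the valuative criterion: properness lifts the generic point to `Spec V → X`. At the
image `x` of the closed point, `V` dominates the local ring, and a valuation ring has no proper
dominating local ring in its fraction field. -/
lemma surjective_valuationSubring {V : ValuationSubring X.FunctionField}
    (hV : ∀ c : K, algebraMap K X.FunctionField c ∈ V) : ∃ x, X.valuationSubring x = V := by
  have hex : ValuativeCriterion.Existence X.str := by
    have := X.proper
    rw [IsProper.eq_valuativeCriterion] at this
    exact this.1.1.1.existence
  obtain ⟨l, hl1, -⟩ := (hex
    { R := V, K := X.FunctionField, commSq := X.valuativeCommSq hV, .. }).exists_lift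
  let x : X.toScheme := l (IsLocalRing.closedPoint V)
  let φ : X.toScheme.presheaf.stalk x ⟶ .of V := Scheme.stalkClosedPointTo (R := .of V) l
  have hφ : IsLocalHom φ.hom := Scheme.isLocalHom_stalkClosedPointTo (R := .of V) l
  have hfac : Spec.map φ ≫ X.toScheme.fromSpecStalk x = l :=
    Scheme.Spec_stalkClosedPointTo_fromSpecStalk (R := .of V) l
  have heq : φ ≫ CommRingCat.ofHom (algebraMap V X.FunctionField) =
      CommRingCat.ofHom (algebraMap (X.toScheme.presheaf.stalk x) X.FunctionField) := by
    apply Spec.map_injective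
    rw [← cancel_mono (X.toScheme.fromSpecStalk x), Spec.map_comp, Category.assoc, hfac,
      SpecMap_algebraMap_fromSpecStalk]
    exact hl1
  have hval : ∀ b, ((φ.hom b : V) : X.FunctionField) = algebraMap _ X.FunctionField b := fun b =>
    congrArg (fun f => f.hom b) heq
  refine ⟨x, le_antisymm ?_ fun a ha => ?_⟩
  · rintro _ ⟨b, rfl⟩
    exact (hval b) ▸ (φ.hom b).2
  · rcases (X.valuationSubring x).mem_or_inv_mem a with h | ⟨b, hb⟩
    · exact h
    by_cases ha0 : a = 0
    · rw [ha0]; exact (X.valuationSubring x).zero_mem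
    have hu : IsUnit (φ.hom b) := by
      refine IsUnit.of_mul_eq_one ⟨a, ha⟩ (Subtype.ext ?_)
      change ((φ.hom b : V) : X.FunctionField) * a = 1
      rw [hval, ← inv_mul_cancel₀ ha0]
      exact congrArg (· * a) hb
    obtain ⟨u, rfl⟩ := hφ.map_nonunit b hu
    refine ⟨↑u⁻¹, ?_⟩
    rw [← inv_inv a]
    refine eq_inv_of_mul_eq_one_left ?_
    rw [← show _ = a⁻¹ from hb]
    change algebraMap _ X.FunctionField _ * algebraMap _ X.FunctionField _ = 1
    rw [← map_mul, Units.inv_mul, map_one]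

lemma isClosed_iff_valuationSubring_ne_top {x : X.toScheme} :
    IsClosed {x} ↔ X.valuationSubring x ≠ ⊤ := by
  refine ⟨fun hx => (X.isDiscrete_valuationSubring hx).ne_top, fun hx => ?_⟩
  obtain ⟨y, hxy, hy⟩ := X.exists_closed_specialization x
  have := (X.isDiscrete_valuationSubring hy).eq_of_le (X.valuationSubring_le_of_specializes hxy) hx
  rwa [X.injective_valuationSubring this] at hy

theorem isPlaceFamily : IsPlaceFamily K X.valuationSubring where
  algebraMap_mem := X.algebraMap_mem_valuationSubring
  injective := X.injective_valuationSubring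
  surjective _ hV := X.surjective_valuationSubring hV
  discrete _ hx := X.isDiscrete_valuationSubring (X.isClosed_iff_valuationSubring_ne_top.2 hx)
  residue _ hx _ ha := X.exists_residue (X.isClosed_iff_valuationSubring_ne_top.2 hx) ha

end Curve

/-! ### Maps of function fields induced by dominant morphisms. -/

section FunctionFieldMap

lemma genericPoint_image_specializes {X Y : Scheme.{u}} [IsIntegral X] (f : X ⟶ Y) [IsDominant f]
    (y : Y) :
    f (genericPoint X) ⤳ y := by
  have h := (genericPoint_spec X).image f.continuous
  rw [specializes_iff_mem_closure, h.def, Set.image_univ, f.denseRange.closure_range]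
  trivial

variable {X Y Z : Scheme.{u}} [IsIntegral X] [IsIntegral Y] [IsIntegral Z]

/-- The map on function fields induced by a dominant morphism of integral schemes. -/
def functionFieldMap (f : X ⟶ Y) [IsDominant f] : Y.functionField →+* X.functionField :=
  (f.stalkMap (genericPoint X)).hom.comp
    (Y.presheaf.stalkSpecializes (genericPoint_image_specializes f (genericPoint Y))).hom

lemma functionFieldMap_algebraMap (f : X ⟶ Y) [IsDominant f] (x : X)
    (a : Y.presheaf.stalk (f x)) :
    functionFieldMap f (algebraMap _ Y.functionField a) =
      algebraMap (X.presheaf.stalk x) X.functionField ((f.stalkMap x).hom a) := by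
  refine Eq.trans (congrArg (f.stalkMap (genericPoint X)).hom
    (Y.presheaf.stalkSpecializes_comp_apply _ _ a)) ?_
  exact Scheme.Hom.stalkSpecializes_stalkMap_apply f _ _ (genericPoint_specializes x) a

lemma functionFieldMap_germ (f : X ⟶ Y) [IsDominant f] (U : Y.Opens)
    (hU : genericPoint Y ∈ U) (hV : genericPoint X ∈ f ⁻¹ᵁ U) (s : Γ(Y, U)) :
    functionFieldMap f ((Y.presheaf.germ U _ hU).hom s) =
      (X.presheaf.germ (f ⁻¹ᵁ U) _ hV).hom ((f.app U).hom s) := by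
  refine Eq.trans (congrArg (f.stalkMap (genericPoint X)).hom
    (Y.presheaf.germ_stalkSpecializes_apply hU _ s)) ?_
  exact Scheme.Hom.germ_stalkMap_apply f U _ hV s

lemma genericPoint_mem_preimage (f : X ⟶ Y) [IsDominant f] {U : Y.Opens}
    (hU : genericPoint Y ∈ U) : genericPoint X ∈ f ⁻¹ᵁ U :=
  (genericPoint_image_specializes f (genericPoint Y)).mem_open U.2 hU

lemma functionFieldMap_comp (f : X ⟶ Y) (g : Y ⟶ Z) [IsDominant f] [IsDominant g]
    [IsDominant (f ≫ g)] (a : Z.functionField) :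
    functionFieldMap (f ≫ g) a = functionFieldMap f (functionFieldMap g a) := by
  obtain ⟨U, hU, s, rfl⟩ := Z.presheaf.exists_germ_eq a
  have hV := genericPoint_mem_preimage g hU
  have h1 := functionFieldMap_germ g U hU hV s
  have h2 := functionFieldMap_germ f _ hV (genericPoint_mem_preimage f hV) ((g.app U).hom s)
  have h3 := functionFieldMap_germ (f ≫ g) U hU (genericPoint_mem_preimage f hV) s
  rw [h1, h2, h3]
  rfl

lemma functionFieldMap_congr {f g : X ⟶ Y} [IsDominant f] [IsDominant g] (h : f = g) :
    functionFieldMap f = functionFieldMap g := by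
  subst h; rfl

/-- The degree of a morphism is defined with the stalk at the image of the generic point. Keeping
that point as a variable `z` allows the equality to be substituted. -/
lemma exists_of_finrank_eq_two {z : Y} (hz : z = genericPoint Y) {F : Type u} [Field F]
    (s : Y.presheaf.stalk z →+* F)
    (h : letI := s.toAlgebra; Module.finrank (Y.presheaf.stalk z) F = 2) :
    ∃ y : F, ∀ a : F, ∃ b c, a = s b + s c * y := by
  subst hz
  let _ : Field (Y.presheaf.stalk (genericPoint Y)) := inferInstanceAs (Field Y.functionField)
  let _ := s.toAlgebra
  change Module.finrank (Y.presheaf.stalk (genericPoint Y)) F = 2 at h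
  have hne : ∃ y : F, ∀ b : Y.presheaf.stalk (genericPoint Y), s b ≠ y := by
    by_contra! hcon
    have : Module.finrank (Y.presheaf.stalk (genericPoint Y)) F ≤ 1 :=
      finrank_le_one (1 : F) fun w => by
        obtain ⟨b, hb⟩ := hcon w
        exact ⟨b, by rw [← hb, Algebra.smul_def, mul_one]; rfl⟩
    omega
  obtain ⟨y, hy⟩ := hne
  have hli : LinearIndependent (Y.presheaf.stalk (genericPoint Y)) ![(1 : F), y] := by
    rw [LinearIndependent.pair_iff' one_ne_zero]
    intro a ha
    rw [Algebra.smul_def, mul_one] at ha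
    exact hy a ha
  have : FiniteDimensional (Y.presheaf.stalk (genericPoint Y)) F :=
    Module.finite_of_finrank_pos (by rw [h]; norm_num)
  have hspan := hli.span_eq_top_of_card_eq_finrank' (by rw [h]; rfl)
  refine ⟨y, fun a => ?_⟩
  have ha : a ∈ Submodule.span (Y.presheaf.stalk (genericPoint Y)) (Set.range ![(1 : F), y]) :=
    hspan ▸ Submodule.mem_top
  rw [Matrix.range_cons, Matrix.range_cons, Matrix.range_empty, Set.union_empty,
    Set.singleton_union, Submodule.mem_span_pair] at ha
  obtain ⟨b, c, rfl⟩ := ha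
  exact ⟨b, c, by rw [Algebra.smul_def, Algebra.smul_def, mul_one]; rfl⟩

end FunctionFieldMap

namespace Curve

variable {K : Type u} [Field K] {X Y : Curve K}

lemma stalkMap_stalkConstants (f : X.toScheme ⟶ Y.toScheme) (hf : f ≫ Y.str = X.str)
    (x : X.toScheme) (c : K) :
    (f.stalkMap x).hom (Y.stalkConstants (f x) c) = X.stalkConstants x c := by
  have h : X.str.appTop = Y.str.appTop ≫ f.appTop := by
    rw [← hf, Scheme.Hom.comp_appTop]
  refine (Scheme.Hom.germ_stalkMap_apply f ⊤ x trivial _).trans ?_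
  change _ = (X.toScheme.presheaf.germ ⊤ x trivial).hom (X.str.appTop.hom _)
  rw [h]
  rfl

lemma functionFieldMap_constants (f : X.toScheme ⟶ Y.toScheme) [IsDominant f]
    (hf : f ≫ Y.str = X.str) (c : K) :
    functionFieldMap f (algebraMap K Y.FunctionField c) = algebraMap K X.FunctionField c := by
  have x := genericPoint X.toScheme
  rw [← Y.algebraMap_stalkConstants (f x), ← X.algebraMap_stalkConstants x,
    ← stalkMap_stalkConstants f hf]
  exact functionFieldMap_algebraMap f x _

/-- The stalk map is local, so the restricted valuation ring dominates the local ring at `f x`; both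
being valuation rings, they agree. -/
lemma valuationSubring_apply [IsAlgClosed K] (f : X.toScheme ⟶ Y.toScheme) [IsDominant f]
    (x : X.toScheme) :
    Y.valuationSubring (f x) = (X.valuationSubring x).comap (functionFieldMap f) := by
  have hle : Y.valuationSubring (f x) ≤ (X.valuationSubring x).comap (functionFieldMap f) := by
    rintro _ ⟨b, rfl⟩
    exact ⟨_, (functionFieldMap_algebraMap f x b).symm⟩
  refine le_antisymm hle fun a ha => ?_
  rcases (Y.valuationSubring (f x)).mem_or_inv_mem a with h | ⟨b, hb⟩
  · exact h
  by_cases ha0 : a = 0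
  · rw [ha0]; exact ZeroMemClass.zero_mem _
  have hu : IsUnit ((f.stalkMap x).hom b) := by
    obtain ⟨c, hc⟩ := ha
    refine IsUnit.of_mul_eq_one c
      (IsFractionRing.injective (X.toScheme.presheaf.stalk x) X.FunctionField ?_)
    rw [map_mul, map_one]
    refine Eq.trans (congrArg₂ (· * ·) ((functionFieldMap_algebraMap f x b).symm.trans
      (congrArg (functionFieldMap f) hb)) hc) ?_
    change functionFieldMap f _ * functionFieldMap f _ = 1
    rw [← map_mul, inv_mul_cancel₀ ha0, map_one]
  have hb' : IsUnit b := (isUnit_map_iff (f.stalkMap x).hom b).1 hu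
  obtain ⟨u, rfl⟩ := hb'
  refine ⟨↑u⁻¹, ?_⟩
  rw [← inv_inv a]
  refine eq_inv_of_mul_eq_one_left ?_
  rw [← show _ = a⁻¹ from hb]
  change algebraMap _ Y.FunctionField _ * algebraMap _ Y.FunctionField _ = 1
  rw [← map_mul, Units.inv_mul, map_one]

lemma exists_quadratic_of_morphismDegree (f : X.toScheme ⟶ Y.toScheme) [IsDominant f]
    (h : morphismDegree f = 2) :
    ∃ y : X.FunctionField, ∀ a, ∃ b c, a = functionFieldMap f b + functionFieldMap f c * y := by
  have hz : f (genericPoint X.toScheme) = genericPoint Y.toScheme :=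
    ((genericPoint_image_specializes f _).antisymm (genericPoint_specializes _)).eq
  obtain ⟨y, hy⟩ := exists_of_finrank_eq_two hz (f.stalkMap (genericPoint X.toScheme)).hom h
  have key : ∀ b, functionFieldMap f (algebraMap _ Y.FunctionField b) =
      (f.stalkMap (genericPoint X.toScheme)).hom b := fun b =>
    (functionFieldMap_algebraMap f _ b).trans
      (congrArg (fun g : X.toScheme.presheaf.stalk _ ⟶ X.toScheme.presheaf.stalk _ =>
        g.hom ((f.stalkMap (genericPoint X.toScheme)).hom b))
        (X.toScheme.presheaf.stalkSpecializes_refl _))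
  refine ⟨y, fun a => ?_⟩
  obtain ⟨b, c, rfl⟩ := hy a
  exact ⟨_, _, congrArg₂ (· + · * y) (key b).symm (key c).symm⟩

end Curve

/-! ### Base change of a double cover. -/

namespace Curve

section BaseChange

variable {k : Type u} [Field k] (K : Type u) [Field K] [Algebra k K] {C E : Curve k}

/-- The projection `C_K → C`. -/
def baseChangeFst (C : Curve k) : (C.baseChange K).toScheme ⟶ C.toScheme :=
  pullback.fst C.str (Spec.map (CommRingCat.ofHom (algebraMap k K)))

lemma isPullback_baseChange (C : Curve k) :
    IsPullback (baseChangeFst K C) (C.baseChange K).str C.str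
      (Spec.map (CommRingCat.ofHom (algebraMap k K))) :=
  IsPullback.of_hasPullback _ _

instance (C : Curve k) : Surjective (baseChangeFst K C) := by
  have : Surjective (Spec.map (CommRingCat.ofHom (algebraMap k K))) := inferInstance
  exact MorphismProperty.of_isPullback (P := @Surjective) (isPullback_baseChange K C).flip this

/-- The base change `π_K : C_K → E_K` of a morphism. -/
def baseChangeMap (π : C.toScheme ⟶ E.toScheme) (hπ : π ≫ E.str = C.str) :
    (C.baseChange K).toScheme ⟶ (E.baseChange K).toScheme :=
  (isPullback_baseChange K E).lift (baseChangeFst K C ≫ π) (C.baseChange K).str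
    (by rw [Category.assoc, hπ, (isPullback_baseChange K C).w])

variable (π : C.toScheme ⟶ E.toScheme) (hπ : π ≫ E.str = C.str)

lemma baseChangeMap_str : baseChangeMap K π hπ ≫ (E.baseChange K).str = (C.baseChange K).str :=
  IsPullback.lift_snd _ _ _ _

lemma baseChangeMap_fst :
    baseChangeMap K π hπ ≫ baseChangeFst K E = baseChangeFst K C ≫ π :=
  IsPullback.lift_fst _ _ _ _

lemma isPullback_baseChangeMap :
    IsPullback (baseChangeMap K π hπ) (baseChangeFst K C) (baseChangeFst K E) π := by
  refine IsPullback.of_right (h₁₂ := (E.baseChange K).str) ?_ (baseChangeMap_fst K π hπ)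
    (isPullback_baseChange K E).flip
  rw [baseChangeMap_str, hπ]
  exact (isPullback_baseChange K C).flip

-- A dominant morphism between proper curves is proper, so its image is closed as well as dense.
include hπ in
lemma surjective_of_isDominant [IsDominant π] : Surjective π := by
  have : IsProper (π ≫ E.str) := hπ ▸ C.proper
  have : IsProper π := IsProper.of_comp π E.str
  infer_instance

lemma surjective_baseChangeMap [IsDominant π] : Surjective (baseChangeMap K π hπ) :=
  MorphismProperty.of_isPullback (P := @Surjective) (isPullback_baseChangeMap K π hπ).flip
    (surjective_of_isDominant π hπ)

/-- If `y ^ 2` is of the form `b + c y` with `b` and `c` in the subfield `L` of `F`, then the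
elements of that form are a subfield. -/
lemma exists_subfield_of_sq {L F : Type*} [Field L] [Field F] (φ : L →+* F) {y : F}
    (hy : ∃ b c, y ^ 2 = φ b + φ c * y) :
    ∃ S : Subfield F, ∀ a, a ∈ S ↔ ∃ b c, a = φ b + φ c * y := by
  let _ := φ.toAlgebra
  obtain ⟨p, q, hpq⟩ := hy
  let S : Subalgebra L F :=
    { carrier := {a | ∃ b c, a = φ b + φ c * y}
      mul_mem' := by
        rintro _ _ ⟨b, c, rfl⟩ ⟨b', c', rfl⟩
        refine ⟨b * b' + c * c' * p, b * c' + c * b' + c * c' * q, ?_⟩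
        simp only [map_add, map_mul]
        linear_combination φ c * φ c' * hpq
      add_mem' := by
        rintro _ _ ⟨b, c, rfl⟩ ⟨b', c', rfl⟩
        exact ⟨b + b', c + c', by simp only [map_add]; ring⟩
      algebraMap_mem' := fun b => ⟨b, 0, by rw [map_zero, zero_mul, add_zero]; rfl⟩ }
  have hyint : IsIntegral L y := by
    refine ⟨Polynomial.X ^ 2 - (Polynomial.C q * Polynomial.X + Polynomial.C p), ?_, ?_⟩
    · refine Polynomial.monic_X_pow_sub (n := 2) ?_
      exact Polynomial.degree_linear_le.trans_lt (by norm_num)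
    · simp only [Polynomial.eval₂_sub, Polynomial.eval₂_pow, Polynomial.eval₂_add,
        Polynomial.eval₂_mul, Polynomial.eval₂_X, Polynomial.eval₂_C]
      rw [hpq]
      change _ - (φ q * y + φ p) = 0
      ring
  refine ⟨{ S.toSubring with inv_mem' := fun a ha => ?_ }, fun a => Iff.rfl⟩
  refine S.inv_mem_of_algebraic (x := ⟨a, ha⟩) ?_
  obtain ⟨b, c, rfl⟩ := ha
  exact ((isIntegral_algebraMap (x := b)).add
    ((isIntegral_algebraMap (x := c)).mul hyint)).isAlgebraic

lemma mem_of_isPushout {A B B' D : CommRingCat.{u}} {f : A ⟶ B} {g : A ⟶ B'} {i : B ⟶ D}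
    {j : B' ⟶ D} (H : IsPushout f g i j) {R : Type u} [CommRing R] (φ : D →+* R) (S : Subring R)
    (h1 : ∀ b, φ (i.hom b) ∈ S) (h2 : ∀ b, φ (j.hom b) ∈ S) (d : D) : φ d ∈ S := by
  let i1 : B ⟶ .of S := CommRingCat.ofHom ((φ.comp i.hom).codRestrict S h1)
  let i2 : B' ⟶ .of S := CommRingCat.ofHom ((φ.comp j.hom).codRestrict S h2)
  have hi : f ≫ i1 = g ≫ i2 := by
    ext s
    exact congrArg φ (congrArg (fun f => f.hom s) H.w)
  have hdesc : H.desc i1 i2 hi ≫ CommRingCat.ofHom S.subtype = CommRingCat.ofHom φ := by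
    apply H.hom_ext
    · rw [← Category.assoc, H.inl_desc]; rfl
    · rw [← Category.assoc, H.inr_desc]; rfl
  rw [← show _ = φ d from congrArg (fun f => f.hom d) hdesc]
  exact (H.desc i1 i2 hi d).2

/-- The function field of `C_K` is generated by `K` and the function field of `C`. -/
lemma eq_top_of_subfield (S : Subfield (C.baseChange K).FunctionField)
    (h1 : ∀ c, algebraMap K (C.baseChange K).FunctionField c ∈ S)
    (h2 : ∀ a, functionFieldMap (baseChangeFst K C) a ∈ S) : S = ⊤ := by
  obtain ⟨U, hU, hη⟩ : ∃ U : C.toScheme.Opens, IsAffineOpen U ∧ genericPoint C.toScheme ∈ U := by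
    obtain ⟨_, ⟨U, hU, rfl⟩, hη, -⟩ := C.toScheme.isBasis_affineOpens.exists_subset_of_mem_open
      (Set.mem_univ (genericPoint C.toScheme)) isOpen_univ
    exact ⟨U, hU, hη⟩
  have hηV := genericPoint_mem_preimage (baseChangeFst K C) hη
  set V := baseChangeFst K C ⁻¹ᵁ U with hVdef
  have : IsAffineHom (baseChangeFst K C) :=
    MorphismProperty.of_isPullback (P := @IsAffineHom) (isPullback_baseChange K C).flip
      inferInstance
  have hV : IsAffineOpen V := hU.preimage (baseChangeFst K C)
  have hVeq : V = baseChangeFst K C ⁻¹ᵁ U ⊓ (C.baseChange K).str ⁻¹ᵁ ⊤ := by simp [hVdef]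
  have : Nonempty V := ⟨⟨_, hηV⟩⟩
  -- Over an affine open `U` of `C` the sections on `C_K` are `Γ(U) ⊗ K`, and their fractions form
  -- the whole function field.
  have hpush := (isIso_pushoutSection_iff (isPullback_baseChange K C) (US := ⊤) (UT := ⊤)
    (UX := U) le_top le_top hVeq).1
    (isIso_pushoutSection_of_isAffineOpen _ _ _ _ (isAffineOpen_top _) (isAffineOpen_top _) hU)
  have hfrac := functionField_isFractionRing_of_isAffineOpen (C.baseChange K).toScheme V hV
  let germ : Γ((C.baseChange K).toScheme, V) →+* (C.baseChange K).FunctionField :=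
    ((C.baseChange K).toScheme.presheaf.germ V _ hηV).hom
  have hgU : ∀ s : Γ(C.toScheme, U), germ (((baseChangeFst K C).appLE U V (by simp [hVeq])).hom s) ∈ S.toSubring := by
    intro s
    have := h2 ((C.toScheme.presheaf.germ U _ hη).hom s)
    rw [functionFieldMap_germ _ U hη hηV] at this
    rw [Scheme.Hom.appLE_eq_app]
    exact this
  have hgK : ∀ s, germ (((C.baseChange K).str.appLE ⊤ V (by simp)).hom s) ∈ S.toSubring := by
    intro s
    have h3 := h1 ((Scheme.ΓSpecIso (.of K)).hom.hom s)
    have h4 : (Scheme.ΓSpecIso (.of K)).inv.hom ((Scheme.ΓSpecIso (.of K)).hom.hom s) = s :=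
      congrArg (fun f => f.hom s) (Scheme.ΓSpecIso (.of K)).hom_inv_id
    change ((C.baseChange K).toScheme.presheaf.germ ⊤ _ _).hom
      ((C.baseChange K).str.appTop.hom _) ∈ S at h3
    rw [h4] at h3
    refine Eq.mp (congrArg (· ∈ S) ?_) h3
    exact ((C.baseChange K).toScheme.presheaf.germ_res_apply (homOfLE le_top) _ hηV _).symm
  have hgerm : ∀ s, germ s ∈ S := mem_of_isPushout hpush germ S.toSubring hgU hgK
  refine top_le_iff.1 fun a _ => ?_
  obtain ⟨b, c, hc, rfl⟩ := IsFractionRing.div_surjective (A := Γ((C.baseChange K).toScheme, V)) a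
  exact div_mem (hgerm b) (hgerm c)

/-- The expressions `b + c y` over the function field of `E_K` form a field, since `y ^ 2` is one of
them. It contains `K` and the function field of `C`, hence everything. -/
lemma exists_quadratic_baseChange [IsDominant π] [IsDominant (baseChangeMap K π hπ)]
    (h : morphismDegree π = 2) :
    ∃ y, ∀ a, ∃ b c, a = functionFieldMap (baseChangeMap K π hπ) b +
      functionFieldMap (baseChangeMap K π hπ) c * y := by
  obtain ⟨y, hy⟩ := exists_quadratic_of_morphismDegree π h
  have hcomm : ∀ b, functionFieldMap (baseChangeFst K C) (functionFieldMap π b) =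
      functionFieldMap (baseChangeMap K π hπ) (functionFieldMap (baseChangeFst K E) b) := by
    intro b
    rw [← functionFieldMap_comp, ← functionFieldMap_comp]
    exact congrArg (fun g => g b) (functionFieldMap_congr (baseChangeMap_fst K π hπ).symm)
  have key : ∀ a, ∃ b c, functionFieldMap (baseChangeFst K C) a =
      functionFieldMap (baseChangeMap K π hπ) b +
      functionFieldMap (baseChangeMap K π hπ) c * functionFieldMap (baseChangeFst K C) y := by
    intro a
    obtain ⟨b, c, rfl⟩ := hy a
    exact ⟨functionFieldMap (baseChangeFst K E) b, functionFieldMap (baseChangeFst K E) c,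
      by rw [map_add, map_mul, hcomm, hcomm]⟩
  have hsq := key (y ^ 2)
  rw [RingHom.map_pow] at hsq
  obtain ⟨S, hS⟩ := exists_subfield_of_sq (functionFieldMap (baseChangeMap K π hπ)) hsq
  have htop := eq_top_of_subfield K S
    (fun c => (hS _).2 ⟨algebraMap K _ c, 0, by
      rw [map_zero, zero_mul, add_zero]
      exact (functionFieldMap_constants _ (baseChangeMap_str K π hπ) c).symm⟩)
    (fun a => (hS _).2 (key a))
  exact ⟨functionFieldMap (baseChangeFst K C) y, fun a => (hS a).1 (htop ▸ Subfield.mem_top a)⟩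

end BaseChange

end Curve

/-! ### The geometric double cover, orders of vanishing, and closed points. -/

namespace Curve

variable {k : Type u} [Field k] (K : Type u) [Field K] [Algebra k K] {C E : Curve k}

lemma isDoubleCover_baseChange [IsAlgClosed K] (π : C.toScheme ⟶ E.toScheme)
    (hπ : π ≫ E.str = C.str) [IsDominant π] [IsDominant (baseChangeMap K π hπ)]
    (h : morphismDegree π = 2) :
    letI := (functionFieldMap (baseChangeMap K π hπ)).toAlgebra
    IsDoubleCover (L := (E.baseChange K).FunctionField) (F := (C.baseChange K).FunctionField)
      K (E.baseChange K).valuationSubring (C.baseChange K).valuationSubring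
      (baseChangeMap K π hπ) := by
  let _ := (functionFieldMap (baseChangeMap K π hπ)).toAlgebra
  have := surjective_baseChangeMap K π hπ
  exact
    { base := (E.baseChange K).isPlaceFamily
      cover := (C.baseChange K).isPlaceFamily
      comap_eq := fun x => valuationSubring_apply (baseChangeMap K π hπ) x
      surjective := (baseChangeMap K π hπ).surjective
      quadratic := exists_quadratic_baseChange K π hπ h }

/-- The abstract repartitions for the family `localRing` unfold to those that define the genus. -/
lemma finrank_H1 : Module.finrank (AlgebraicClosure k)
    (Repartition.H1 (C.baseChange (AlgebraicClosure k)).localRing) = C.genus := rfl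

variable {K}

/-! ### Orders of vanishing -/

section Order

variable [IsAlgClosed K] (X : Curve K) {x : X.toScheme} (hx : IsClosed {x})

include hx

lemma coheight_eq_one : Order.coheight x = 1 := by
  have := X.isDiscreteValuationRing_stalk x hx
  rw [← WithBot.coe_inj, ← ringKrullDim_stalk_eq_coheight]
  exact IsDiscreteValuationRing.ringKrullDim_eq_one _

/-- `f` and `b ^ ord f` have the same order, so they differ by a unit of the local ring. This
translates divisors into valuations. -/
lemma valuation_eq_zpow_ord {b : X.toScheme.presheaf.stalk x} (hb : Irreducible b)
    {f : X.FunctionField} (hf : f ≠ 0) :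
    (X.valuationSubring x).valuation f =
      (X.valuationSubring x).valuation (algebraMap _ X.FunctionField b) ^ Scheme.ord f x := by
  have := X.isDiscreteValuationRing_stalk x hx
  have h1 := (Scheme.ord_eq_iff (X.coheight_eq_one hx) hf).1 rfl
  have h2 : Ring.ordFrac (X.toScheme.presheaf.stalk x)
      ((algebraMap (X.toScheme.presheaf.stalk x) X.FunctionField b) ^ Scheme.ord f x) =
        Ring.ordFrac (X.toScheme.presheaf.stalk x) f := by
    rw [map_zpow₀, Ring.ordFrac_irreducible hb]
    refine Eq.trans ?_ h1.symm
    rw [← WithZero.exp_zsmul]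
    simp [WithZero.exp]
  obtain ⟨u, hu⟩ := Ring.associated_of_ordFrac_eq _ _ h2
  refine (congrArg (X.valuationSubring x).valuation hu).symm.trans ?_
  rw [Units.smul_def, Algebra.smul_def, map_mul, X.valuation_algebraMap_unit u.isUnit, one_mul]
  exact map_zpow₀ _ _ _

lemma isUniformizer_of_ord_eq_one {f : X.FunctionField} (hf : f ≠ 0) (h : Scheme.ord f x = 1) :
    (X.valuationSubring x).IsUniformizer f := by
  have := X.isDiscreteValuationRing_stalk x hx
  obtain ⟨b, hb⟩ := IsDiscreteValuationRing.exists_irreducible (X.toScheme.presheaf.stalk x)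
  have h1 := X.valuation_eq_zpow_ord hx hb hf
  rw [h, zpow_one] at h1
  rw [ValuationSubring.IsUniformizer, h1]
  exact X.isUniformizer_algebraMap hx hb

lemma isUniformizer_inv_of_ord_eq_neg_one {f : X.FunctionField} (hf : f ≠ 0)
    (h : Scheme.ord f x = -1) : (X.valuationSubring x).IsUniformizer f⁻¹ := by
  have := X.isDiscreteValuationRing_stalk x hx
  obtain ⟨b, hb⟩ := IsDiscreteValuationRing.exists_irreducible (X.toScheme.presheaf.stalk x)
  have h1 := X.valuation_eq_zpow_ord hx hb hf
  rw [h, zpow_neg_one] at h1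
  rw [ValuationSubring.IsUniformizer, map_inv₀, h1, inv_inv]
  exact X.isUniformizer_algebraMap hx hb

lemma valuation_eq_one_of_ord_eq_zero {f : X.FunctionField} (hf : f ≠ 0)
    (h : Scheme.ord f x = 0) : (X.valuationSubring x).valuation f = 1 := by
  have := X.isDiscreteValuationRing_stalk x hx
  obtain ⟨b, hb⟩ := IsDiscreteValuationRing.exists_irreducible (X.toScheme.presheaf.stalk x)
  have h1 := X.valuation_eq_zpow_ord hx hb hf
  rwa [h, zpow_zero] at h1

end Order

namespace Points

/-- A point with values in `K`, as a section of `C_K`. -/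
def toSection (P : C.Points K) : Spec (.of K) ⟶ (C.baseChange K).toScheme :=
  (isPullback_baseChange K C).lift P.1 (𝟙 _) (by rw [P.2, Category.id_comp])

lemma toSection_fst (P : C.Points K) : P.toSection ≫ baseChangeFst K C = P.1 :=
  IsPullback.lift_fst _ _ _ _

lemma toSection_str (P : C.Points K) : P.toSection ≫ (C.baseChange K).str = 𝟙 _ :=
  IsPullback.lift_snd _ _ _ _

lemma closedPoint_eq (P : C.Points K) :
    P.closedPoint = P.toSection (IsLocalRing.closedPoint K) := by
  have : P.toSection = pullback.lift P.1 (𝟙 _) (by rw [P.2, Category.id_comp]) := by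
    apply (isPullback_baseChange K C).hom_ext
    · rw [toSection_fst]; exact (pullback.lift_fst _ _ _).symm
    · rw [toSection_str]; exact (pullback.lift_snd _ _ _).symm
  rw [this]; rfl

lemma map_closedPoint (P : C.Points K) (π : C.toScheme ⟶ E.toScheme) (hπ : π ≫ E.str = C.str) :
    (P.map π hπ).closedPoint = baseChangeMap K π hπ P.closedPoint := by
  rw [closedPoint_eq, closedPoint_eq]
  have : (P.map π hπ).toSection = P.toSection ≫ baseChangeMap K π hπ := by
    apply (isPullback_baseChange K E).hom_ext
    · rw [toSection_fst, Category.assoc, baseChangeMap_fst, ← Category.assoc, toSection_fst]; rfl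
    · rw [toSection_str, Category.assoc, baseChangeMap_str, toSection_str]
  rw [this]; rfl

variable [IsAlgClosed K]

lemma isClosed_closedPoint (P : C.Points K) : IsClosed {P.closedPoint} := by
  rw [closedPoint_eq]
  exact (pointEquivClosedPoint (C.baseChange K).str ⟨_, P.toSection_str⟩).2

lemma closedPoint_injective :
    Function.Injective (closedPoint : C.Points K → (C.baseChange K).toScheme) := by
  intro P Q h
  rw [closedPoint_eq, closedPoint_eq] at h
  have := ext_of_apply_closedPoint_eq (C.baseChange K).str P.toSection_str Q.toSection_str h
  exact Subtype.ext (by rw [← toSection_fst, this, toSection_fst])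

lemma exists_closedPoint_eq {x : (C.baseChange K).toScheme} (hx : IsClosed {x}) :
    ∃ P : C.Points K, P.closedPoint = x := by
  let s := pointOfClosedPoint (C.baseChange K).str x hx
  have hs : s ≫ (C.baseChange K).str = 𝟙 _ := pointOfClosedPoint_comp _ _ _
  have hP : (s ≫ baseChangeFst K C) ≫ C.str = Spec.map (CommRingCat.ofHom (algebraMap k K)) := by
    rw [Category.assoc, (isPullback_baseChange K C).w, ← Category.assoc, hs, Category.id_comp]
  let P : C.Points K := ⟨s ≫ baseChangeFst K C, hP⟩
  have hPs : P.toSection = s := by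
    apply (isPullback_baseChange K C).hom_ext
    · rw [toSection_fst]
    · rw [toSection_str, hs]
  refine ⟨P, ?_⟩
  rw [closedPoint_eq, hPs]
  exact pointOfClosedPoint_apply _ _ _ _

end Points
end Curve

/-! ### Galois conjugates of points. -/

namespace Curve

namespace Points

section Conj

variable {k : Type u} [Field k] {K : Type u} [Field K] [Algebra k K] {C E : Curve k}

/-- The embedding of the residue field that belongs to a point with values in `K`. -/
def residueEmb (P : C.Points K) :
    C.toScheme.residueField (P.1 (IsLocalRing.closedPoint K)) ⟶ .of K :=
  C.toScheme.descResidueField (Scheme.stalkClosedPointTo P.1)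

lemma field_eq (P : C.Points K) :
    P.field = IntermediateField.adjoin k (Set.range P.residueEmb.hom) := rfl

lemma residueEmb_spec (P : C.Points K) :
    Spec.map P.residueEmb ≫ C.toScheme.fromSpecResidueField _ = P.1 :=
  Scheme.descResidueField_stalkClosedPointTo_fromSpecResidueField K C.toScheme P.1

/-- A point with values in `K` is a point of the scheme with an embedding of its residue field in
`K`. Conjugation keeps the former and composes the latter with the automorphism. -/
lemma conj_eq_conj_iff (P : C.Points K) (σ τ : K ≃ₐ[k] K) :
    P.conj σ = P.conj τ ↔ ∀ a ∈ P.field, σ a = τ a := by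
  have key : ∀ σ : K ≃ₐ[k] K, (P.conj σ).1 =
      (Scheme.SpecToEquivOfField K C.toScheme).symm
        ⟨_, P.residueEmb ≫ CommRingCat.ofHom (σ : K →+* K)⟩ := by
    intro σ
    change Spec.map (CommRingCat.ofHom (σ : K →+* K)) ≫ P.1 = Spec.map _ ≫ _
    rw [Spec.map_comp, Category.assoc, residueEmb_spec]
  have hiff : P.conj σ = P.conj τ ↔
      P.residueEmb ≫ CommRingCat.ofHom (σ : K →+* K) =
        P.residueEmb ≫ CommRingCat.ofHom (τ : K →+* K) := by
    refine Subtype.ext_iff.trans ?_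
    rw [key, key, Equiv.apply_eq_iff_eq, Sigma.mk.injEq]
    simp only [true_and, heq_eq_eq]
  rw [hiff]
  constructor
  · intro h
    have hle : P.field ≤ IntermediateField.fixedField (Subgroup.zpowers (τ⁻¹ * σ)) := by
      rw [field_eq, IntermediateField.adjoin_le_iff]
      rintro _ ⟨a, rfl⟩
      rintro ⟨g, hg⟩
      have h1 : σ (P.residueEmb.hom a) = τ (P.residueEmb.hom a) :=
        congrArg (fun f => f.hom a) h
      have h2 : (τ⁻¹ * σ) ∈ MulAction.stabilizer (K ≃ₐ[k] K) (P.residueEmb.hom a) := by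
        rw [MulAction.mem_stabilizer_iff, mul_smul, inv_smul_eq_iff]
        exact h1
      exact (Subgroup.zpowers_le.2 h2) hg
    intro a ha
    have := hle ha ⟨_, Subgroup.mem_zpowers _⟩
    change (τ⁻¹ * σ) • a = a at this
    rw [mul_smul, inv_smul_eq_iff] at this
    exact this
  · intro h
    ext a
    exact h _ (IntermediateField.subset_adjoin _ _ ⟨a, rfl⟩)

lemma field_map_le (P : C.Points K) (π : C.toScheme ⟶ E.toScheme) (hπ : π ≫ E.str = C.str) :
    (P.map π hπ).field ≤ P.field := by
  have h := Scheme.descResidueField_stalkClosedPointTo_comp π P.1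
  rw [field_eq, IntermediateField.adjoin_le_iff]
  rintro _ ⟨a, rfl⟩
  refine IntermediateField.subset_adjoin _ _ ⟨(π.residueFieldMap _).hom a, ?_⟩
  exact (congrArg (fun f => f.hom a) h).symm

lemma conj_conj (P : C.Points K) (σ τ : K ≃ₐ[k] K) : (P.conj τ).conj σ = P.conj (σ * τ) := by
  refine Subtype.ext ?_
  change Spec.map _ ≫ Spec.map _ ≫ P.1 = Spec.map _ ≫ P.1
  rw [← Category.assoc, ← Spec.map_comp]
  rfl

lemma conj_one (P : C.Points K) : P.conj (1 : K ≃ₐ[k] K) = P := by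
  refine Subtype.ext ?_
  change Spec.map (𝟙 (CommRingCat.of K)) ≫ P.1 = P.1
  rw [Spec.map_id, Category.id_comp]

lemma map_conj (P : C.Points K) (σ : K ≃ₐ[k] K) (π : C.toScheme ⟶ E.toScheme)
    (hπ : π ≫ E.str = C.str) : (P.conj σ).map π hπ = (P.map π hπ).conj σ :=
  Subtype.ext (Category.assoc _ _ _)

/-- The set of conjugates of a point. -/
def orbit (P : C.Points K) : Set (C.Points K) := Set.range fun σ : K ≃ₐ[k] K => P.conj σ

lemma mem_orbit_self (P : C.Points K) : P ∈ P.orbit := ⟨1, P.conj_one⟩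

lemma conj_mem_orbit {P Q : C.Points K} (h : Q ∈ P.orbit) (σ : K ≃ₐ[k] K) :
    Q.conj σ ∈ P.orbit := by
  obtain ⟨τ, rfl⟩ := h
  exact ⟨σ * τ, (P.conj_conj σ τ).symm⟩

lemma mem_orbit_symm {P Q : C.Points K} (h : Q ∈ P.orbit) : P ∈ Q.orbit := by
  obtain ⟨τ, rfl⟩ := h
  refine ⟨τ⁻¹, ?_⟩
  change (P.conj τ).conj τ⁻¹ = P
  rw [conj_conj, inv_mul_cancel, conj_one]

lemma mem_orbit_trans {P Q R : C.Points K} (h : Q ∈ P.orbit) (h' : R ∈ Q.orbit) : R ∈ P.orbit := by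
  obtain ⟨τ, rfl⟩ := h'
  exact conj_mem_orbit h τ

lemma map_mem_orbit {P Q : C.Points K} (h : Q ∈ P.orbit) (π : C.toScheme ⟶ E.toScheme)
    (hπ : π ≫ E.str = C.str) : Q.map π hπ ∈ (P.map π hπ).orbit := by
  obtain ⟨τ, rfl⟩ := h
  exact ⟨τ, (P.map_conj τ π hπ).symm⟩

lemma exists_map_eq_of_mem_orbit {P : C.Points K} (π : C.toScheme ⟶ E.toScheme)
    (hπ : π ≫ E.str = C.str) {R : E.Points K} (h : R ∈ (P.map π hπ).orbit) :
    ∃ Q ∈ P.orbit, Q.map π hπ = R := by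
  obtain ⟨τ, rfl⟩ := h
  exact ⟨P.conj τ, ⟨τ, rfl⟩, P.map_conj τ π hπ⟩

/-- Conjugates of `P` correspond to embeddings of `k(P)` in `K`: each embedding extends to an
automorphism, and separability makes their number the degree. -/
lemma finite_orbit_and_ncard [PerfectField k] [IsAlgClosed K] [Algebra.IsAlgebraic k K]
    (P : C.Points K) [FiniteDimensional k P.field] :
    P.orbit.Finite ∧ P.orbit.ncard = P.degree := by
  let e : P.orbit → (P.field →ₐ[k] K) := fun Q => (Q.2.choose : K →ₐ[k] K).comp P.field.val
  have he : ∀ (σ : K ≃ₐ[k] K) (hQ : P.conj σ ∈ P.orbit),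
      e ⟨_, hQ⟩ = (σ : K →ₐ[k] K).comp P.field.val := by
    intro σ hQ
    ext ⟨a, ha⟩
    exact (P.conj_eq_conj_iff _ _).1 hQ.choose_spec a ha
  have hbij : Function.Bijective e := by
    constructor
    · rintro ⟨_, σ, rfl⟩ ⟨_, τ, rfl⟩ h
      replace h := ((he σ ⟨σ, rfl⟩).symm.trans h).trans (he τ ⟨τ, rfl⟩)
      exact Subtype.ext ((P.conj_eq_conj_iff _ _).2 fun a ha =>
        congrArg (fun f : P.field →ₐ[k] K => f ⟨a, ha⟩) h)
    · intro φ
      have : Normal k K := ⟨fun x => IsAlgClosed.splits _⟩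
      let ψ : K ≃ₐ[k] K := AlgEquiv.ofBijective (φ.liftNormal K) (AlgHom.normal_bijective k K K _)
      refine ⟨⟨P.conj ψ, ψ, rfl⟩, ?_⟩
      refine (he ψ ⟨ψ, rfl⟩).trans ?_
      ext a
      exact φ.liftNormal_commutes K a
  have hfin : Finite P.orbit := Finite.of_injective e hbij.1
  refine ⟨hfin, ?_⟩
  rw [← Nat.card_coe_set_eq, Nat.card_congr (Equiv.ofBijective e hbij), Nat.card_eq_fintype_card]
  exact AlgHom.card k P.field K

end Conj

end Points
end Curve

/-! ### Orbit sums as divisors, and functions whose divisor is a difference of two orbits. -/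

namespace Curve

section OrbitDivisor

variable {k : Type u} [Field k] {C : Curve k}

open Classical in
/-- The sum of a finite set of points, as a divisor. -/
def sumDivisor (S : Set C.AlgPoints) (hS : S.Finite) : C.GeomDivisor :=
  ∑ Q ∈ hS.toFinset, Finsupp.single Q 1

open Classical in
lemma sumDivisor_apply {S : Set C.AlgPoints} (hS : S.Finite) (Q : C.AlgPoints) :
    sumDivisor S hS Q = if Q ∈ S then 1 else 0 := by
  rw [sumDivisor, Finsupp.finsetSum_apply]
  simp [Finsupp.single_apply]

lemma divisorDegree_sumDivisor {S : Set C.AlgPoints} (hS : S.Finite) :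
    C.divisorDegree (sumDivisor S hS) = S.ncard := by
  rw [sumDivisor, map_sum, Set.ncard_eq_toFinset_card S hS]
  simp [divisorDegree]

lemma conj_injective (σ : AlgebraicClosure k ≃ₐ[k] AlgebraicClosure k) :
    Function.Injective (Points.conj (C := C) σ) := by
  intro P Q h
  have := congrArg (Points.conj σ⁻¹) h
  rwa [Points.conj_conj, Points.conj_conj, inv_mul_cancel, Points.conj_one, Points.conj_one] at this

lemma divisorConj_sumDivisor_orbit (σ : AlgebraicClosure k ≃ₐ[k] AlgebraicClosure k)
    (P : C.AlgPoints) (hS : P.orbit.Finite) :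
    C.divisorConj σ (sumDivisor P.orbit hS) = sumDivisor P.orbit hS := by
  classical
  have h : hS.toFinset.image (Points.conj σ) = hS.toFinset := by
    refine Finset.eq_of_subset_of_card_le ?_ ?_
    · intro Q hQ
      rw [Finset.mem_image] at hQ
      obtain ⟨R, hR, rfl⟩ := hQ
      rw [Set.Finite.mem_toFinset] at hR ⊢
      exact Points.conj_mem_orbit hR σ
    · rw [Finset.card_image_of_injective _ (conj_injective σ)]
  rw [sumDivisor, map_sum]
  conv_rhs => rw [← h, Finset.sum_image (fun _ _ _ _ h => conj_injective σ h)]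
  refine Finset.sum_congr rfl fun Q _ => ?_
  exact Finsupp.mapDomain_single

end OrbitDivisor

section Bielliptic

variable {k : Type u} [Field k] {C E : Curve k}

/-- If the difference of the sums over two distinct Galois orbits is principal, and the second
orbit has at most `g - 2` elements, then `π` is two to one on the first orbit and not constant on
the second. -/
lemma orbit_ncard_eq_two_mul [CharZero k] {π : C.toScheme ⟶ E.toScheme}
    (hπ : IsBiellipticMap π) {P P' : C.AlgPoints} (hP : P.orbit.Finite) (hP' : P'.orbit.Finite)
    (hne : P' ∉ P.orbit) (hg : P'.orbit.ncard + 2 ≤ C.genus)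
    (hD : sumDivisor P.orbit hP - sumDivisor P'.orbit hP' ∈ C.principalDivisors) :
    P.orbit.ncard = 2 * (P.map π hπ.comp_str).orbit.ncard ∧
      ((P'.map π hπ.comp_str).orbit.ncard ≠ 1) := by
  classical
  have := hπ.dominant
  have := surjective_baseChangeMap (AlgebraicClosure k) π hπ.comp_str
  have : CharZero (AlgebraicClosure k) := charZero_of_injective_algebraMap
    (algebraMap k (AlgebraicClosure k)).injective
  let _ := (functionFieldMap (baseChangeMap (AlgebraicClosure k) π hπ.comp_str)).toAlgebra
  have hcov := isDoubleCover_baseChange (AlgebraicClosure k) π hπ.comp_str hπ.degree_eq_two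
  have : IsScalarTower (AlgebraicClosure k) (E.baseChange (AlgebraicClosure k)).FunctionField
      (C.baseChange (AlgebraicClosure k)).FunctionField :=
    IsScalarTower.of_algebraMap_eq fun c => (functionFieldMap_constants _
      (baseChangeMap_str (AlgebraicClosure k) π hπ.comp_str) c).symm
  let X := C.baseChange (AlgebraicClosure k)
  let p := baseChangeMap (AlgebraicClosure k) π hπ.comp_str
  obtain ⟨f, hf0, hf⟩ := hD
  have hdisj : ∀ Q, Q ∈ P.orbit → Q ∉ P'.orbit := fun Q h h' =>
    hne (Points.mem_orbit_trans h (Points.mem_orbit_symm h'))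
  have hzero : ∀ Q ∈ P.orbit, Scheme.ord f Q.closedPoint = 1 := fun Q hQ => by
    rw [← hf, Finsupp.sub_apply, sumDivisor_apply, sumDivisor_apply, if_pos hQ,
      if_neg (hdisj Q hQ), sub_zero]
  have hpole : ∀ Q ∈ P'.orbit, Scheme.ord f Q.closedPoint = -1 := fun Q hQ => by
    rw [← hf, Finsupp.sub_apply, sumDivisor_apply, sumDivisor_apply, if_pos hQ,
      if_neg (fun h => hdisj Q h hQ), zero_sub]
  have hunit : ∀ Q : C.AlgPoints, Q ∉ P.orbit → Q ∉ P'.orbit → Scheme.ord f Q.closedPoint = 0 :=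
    fun Q hQ hQ' => by
      rw [← hf, Finsupp.sub_apply, sumDivisor_apply, sumDivisor_apply, if_neg hQ, if_neg hQ',
        sub_zero]
  let T : Finset X.toScheme := hP'.toFinset.image Points.closedPoint
  have hmemT : ∀ x, x ∈ T ↔ ∃ Q ∈ P'.orbit, Q.closedPoint = x := by
    intro x
    simp only [T, Finset.mem_image, Set.Finite.mem_toFinset]
  have hTu : ∀ x ∈ T, (X.valuationSubring x).IsUniformizer f⁻¹ := by
    intro x hx
    obtain ⟨Q, hQ, rfl⟩ := (hmemT x).1 hx
    exact X.isUniformizer_inv_of_ord_eq_neg_one Q.isClosed_closedPoint hf0 (hpole Q hQ)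
  have hTtop : ∀ x ∈ T, X.valuationSubring x ≠ ⊤ := by
    intro x hx
    obtain ⟨Q, hQ, rfl⟩ := (hmemT x).1 hx
    exact X.isClosed_iff_valuationSubring_ne_top.1 Q.isClosed_closedPoint
  have hreg : ∀ x, x ∉ T → f ∈ X.valuationSubring x := by
    intro x hx
    by_cases hc : IsClosed {x}
    · obtain ⟨Q, rfl⟩ := Points.exists_closedPoint_eq hc
      have hQ : Q ∉ P'.orbit := fun h => hx ((hmemT _).2 ⟨Q, h, rfl⟩)
      rw [← ValuationSubring.valuation_le_one_iff]
      by_cases hQ' : Q ∈ P.orbit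
      · exact (X.isUniformizer_of_ord_eq_one hc hf0 (hzero Q hQ')).1.le
      · exact (X.valuation_eq_one_of_ord_eq_zero hc hf0 (hunit Q hQ' hQ)).le
    · rw [isClosed_iff_valuationSubring_ne_top, not_not] at hc
      rw [hc]
      trivial
  have hTcard : T.card + 2 ≤ Module.finrank (AlgebraicClosure k) (Repartition.H1 X.localRing) := by
    refine le_trans ?_ (hg.trans_eq (finrank_H1 (C := C)).symm)
    rw [Set.ncard_eq_toFinset_card _ hP']
    exact Nat.add_le_add_right Finset.card_image_le 2
  have hE1 : Module.finrank (AlgebraicClosure k)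
      (Repartition.H1 (E.baseChange (AlgebraicClosure k)).localRing) = 1 := hπ.genus_eq_one
  -- The poles of `f` are the points of the second orbit, too few for Castelnuovo and Severi, so `f`
  -- is the pullback of some `g`.
  obtain ⟨⟨g, hgf⟩, t, ht1, ht2, ht3⟩ := hcov.exists_conj
    (E.baseChange (AlgebraicClosure k)).mem_localRing_iff X.mem_localRing_iff hE1
    (T := T) ⟨P'.closedPoint, (hmemT _).2 ⟨P', P'.mem_orbit_self, rfl⟩⟩ hTtop hTu hreg hTcard
  have hmem_comap : ∀ x a, a ∈ (E.baseChange (AlgebraicClosure k)).valuationSubring (p x) ↔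
    algebraMap _ X.FunctionField a ∈ X.valuationSubring x := hcov.mem_iff
  have hu_notMem : ∀ {x : X.toScheme} {h : X.FunctionField},
      (X.valuationSubring x).IsUniformizer h → h ≠ 0 → h⁻¹ ∉ X.valuationSubring x := by
    intro x h hh h0 hmem
    rw [← ValuationSubring.valuation_le_one_iff, map_inv₀] at hmem
    have h1 := hh.1
    have h2 : (X.valuationSubring x).valuation h ≠ 0 := by simpa using h0
    exact absurd hmem (not_le.2 ((one_lt_inv₀ (zero_lt_iff.2 h2)).2 h1))
  have hpt : ∀ Q R : C.AlgPoints, Q.map π hπ.comp_str = R.map π hπ.comp_str ↔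
      p Q.closedPoint = p R.closedPoint := by
    intro Q R
    rw [← Points.map_closedPoint, ← Points.map_closedPoint, Points.closedPoint_injective.eq_iff]
  -- The partner of a zero `Q` is its conjugate. It differs from `Q` because `f` is a uniformizer at
  -- `Q` coming from the base, and it is again a zero because `f` depends only on the image in `E`;
  -- the zeros are exactly the orbit of `P`.
  have hsecond : ∀ Q ∈ P.orbit, ∃ Q' ∈ P.orbit, Q' ≠ Q ∧
      ∀ R, R.map π hπ.comp_str = Q.map π hπ.comp_str ↔ R = Q ∨ R = Q' := by
    intro Q hQ
    have hQt := X.isClosed_iff_valuationSubring_ne_top.1 Q.isClosed_closedPoint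
    have hQu := X.isUniformizer_of_ord_eq_one Q.isClosed_closedPoint hf0 (hzero Q hQ)
    have hneQ := ht3 Q.closedPoint g hQt (by rw [hgf]; exact hQu)
    have h1 : f ∈ X.valuationSubring (t Q.closedPoint) := by
      rw [← hgf, ← hmem_comap, ht1, hmem_comap, hgf, ← ValuationSubring.valuation_le_one_iff]
      exact hQu.1.le
    have h2 : f⁻¹ ∉ X.valuationSubring (t Q.closedPoint) := by
      rw [← hgf, ← map_inv₀, ← hmem_comap, ht1, hmem_comap, map_inv₀, hgf]
      exact hu_notMem hQu hf0
    have hc : IsClosed {t Q.closedPoint} := by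
      rw [isClosed_iff_valuationSubring_ne_top]
      intro htop
      rw [htop] at h2
      exact h2 trivial
    obtain ⟨Q', hQ'⟩ := Points.exists_closedPoint_eq hc
    rw [← hQ'] at h1 h2
    have hpQ' : p Q'.closedPoint = p Q.closedPoint := by rw [hQ']; exact ht1 _
    refine ⟨Q', ?_, ?_, fun R => ?_⟩
    · by_contra hQ'1
      by_cases hQ'2 : Q' ∈ P'.orbit
      · have := hu_notMem (hTu _ ((hmemT _).2 ⟨Q', hQ'2, rfl⟩)) (inv_ne_zero hf0)
        rw [inv_inv] at this
        exact this h1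
      · apply h2
        rw [← ValuationSubring.valuation_le_one_iff, map_inv₀,
          X.valuation_eq_one_of_ord_eq_zero Q'.isClosed_closedPoint hf0 (hunit Q' hQ'1 hQ'2),
          inv_one]
    · rintro rfl
      exact hneQ hQ'.symm
    · rw [hpt]
      constructor
      · intro h
        refine (ht2 _ _ hQt h).imp (fun h => Points.closedPoint_injective h) fun h => ?_
        exact Points.closedPoint_injective (h.trans hQ'.symm)
      · rintro (rfl | rfl)
        · rfl
        · exact hpQ'
  constructor
  · have himage : (P.map π hπ.comp_str).orbit =
        (hP.toFinset.image (Points.map π hπ.comp_str) : Finset E.AlgPoints) := by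
      ext R
      simp only [Finset.coe_image, Set.Finite.coe_toFinset, Set.mem_image]
      constructor
      · exact fun h => Points.exists_map_eq_of_mem_orbit π hπ.comp_str h
      · rintro ⟨Q, hQ, rfl⟩
        exact Points.map_mem_orbit hQ π hπ.comp_str
    rw [himage, Set.ncard_coe_finset, Set.ncard_eq_toFinset_card _ hP, mul_comm]
    refine Finset.card_eq_sum_card_image (Points.map π hπ.comp_str) _ |>.trans ?_
    refine (Finset.sum_const_nat fun R hR => ?_)
    rw [Finset.mem_image] at hR
    obtain ⟨Q, hQ, rfl⟩ := hR
    rw [Set.Finite.mem_toFinset] at hQ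
    obtain ⟨Q', hQ', hne', hiff⟩ := hsecond Q hQ
    rw [Finset.card_eq_two]
    refine ⟨Q, Q', hne'.symm, ?_⟩
    ext R
    rw [Finset.mem_filter, Set.Finite.mem_toFinset, hiff, Finset.mem_insert, Finset.mem_singleton]
    constructor
    · exact fun h => h.2
    · rintro (rfl | rfl)
      · exact ⟨hQ, Or.inl rfl⟩
      · exact ⟨hQ', Or.inr rfl⟩
  · intro hone
    have hP'T := (hmemT _).2 ⟨P', P'.mem_orbit_self, rfl⟩
    have hfP' : f ∉ X.valuationSubring P'.closedPoint := by
      have := hu_notMem (hTu _ hP'T) (inv_ne_zero hf0)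
      rwa [inv_inv] at this
    -- If the second orbit has a single image in `E`, all poles of `f` lie in one fibre, and `g` has
    -- just one simple pole.
    refine hcov.false_of_simple_poles_in_fibre
      (E.baseChange (AlgebraicClosure k)).mem_localRing_iff hE1 (g := g) (x := P'.closedPoint)
      (hTtop _ hP'T) ?_ (by rw [hgf]; exact hTu _ hP'T) ?_
    · intro htop
      have : g ∈ (E.baseChange (AlgebraicClosure k)).valuationSubring (p P'.closedPoint) := by
        rw [show _ = _ from htop]; trivial
      rw [hmem_comap, hgf] at this
      exact hfP' this
    · intro x hx
      rw [hgf]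
      refine hreg x fun hxT => hx ?_
      obtain ⟨Q, hQ, rfl⟩ := (hmemT _).1 hxT
      obtain ⟨R, hR⟩ := Set.ncard_eq_one.1 hone
      have h1 := Points.map_mem_orbit hQ π hπ.comp_str
      have h2 := (P'.map π hπ.comp_str).mem_orbit_self
      rw [hR, Set.mem_singleton_iff] at h1 h2
      exact (hpt Q P').1 (h1.trans h2.symm)

end Bielliptic

end Curve

/-! ### Finiteness from the Jacobian. -/

namespace Curve

variable {k : Type u} [Field k] {C E : Curve k}

lemma sumDivisor_sub_mem_invariantClassDivisors {P P' : C.AlgPoints} (hP : P.orbit.Finite)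
    (hP' : P'.orbit.Finite) (h : P.orbit.ncard = P'.orbit.ncard) :
    sumDivisor P.orbit hP - sumDivisor P'.orbit hP' ∈ C.invariantClassDivisors := by
  refine ⟨?_, fun σ => ?_⟩
  · rw [map_sub, divisorDegree_sumDivisor, divisorDegree_sumDivisor, h, sub_self]
  · rw [map_sub, divisorConj_sumDivisor_orbit, divisorConj_sumDivisor_orbit, sub_self]
    exact zero_mem _

/-- The orbit sums, minus that of a fixed point of `S`, define a map from `S` to the finite group
`J(k)`. By `hS` each fibre lies in one orbit, which is finite. -/
lemma finite_of_finite_jacobianRationalPoints [PerfectField k]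
    (hJ : Finite C.jacobianRationalPoints) {d : ℕ} {S : Set C.AlgPoints}
    (hfin : ∀ P ∈ S, P.orbit.Finite) (hcard : ∀ P ∈ S, P.orbit.ncard = d)
    (hS : ∀ (P) (hP : P ∈ S) (P') (hP' : P' ∈ S),
      sumDivisor P.orbit (hfin P hP) - sumDivisor P'.orbit (hfin P' hP') ∈ C.principalDivisors →
        P' ∈ P.orbit) : S.Finite := by
  rcases S.eq_empty_or_nonempty with rfl | ⟨P₀, h₀⟩
  · exact Set.finite_empty
  let c : S → C.jacobianRationalPoints := fun P =>
    ⟨QuotientAddGroup.mk' C.principalDivisors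
      (sumDivisor P.1.orbit (hfin P P.2) - sumDivisor P₀.orbit (hfin P₀ h₀)),
      AddSubgroup.mem_map_of_mem _ (sumDivisor_sub_mem_invariantClassDivisors _ _
        ((hcard P P.2).trans (hcard P₀ h₀).symm))⟩
  have hc : ∀ P P' : S, c P = c P' → P'.1 ∈ P.1.orbit := by
    intro P P' h
    refine hS P.1 P.2 P'.1 P'.2 ?_
    have h1 := (QuotientAddGroup.eq_iff_sub_mem).1 (Subtype.ext_iff.1 h)
    rwa [sub_sub_sub_cancel_right] at h1
  have hfib : ∀ y, Finite (c ⁻¹' {y}) := by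
    intro y
    rcases (c ⁻¹' {y}).eq_empty_or_nonempty with h | ⟨P, hP⟩
    · rw [h]; infer_instance
    · refine Set.Finite.subset ((hfin P.1 P.2).preimage Subtype.val_injective.injOn) ?_
      intro P' hP'
      exact hc P P' (hP.trans hP'.symm)
  have hun : (Set.univ : Set S) = ⋃ y, c ⁻¹' {y} := by ext; simp
  have : (Set.univ : Set S).Finite := hun ▸ Set.finite_iUnion hfib
  exact Set.finite_univ_iff.1 this

/-- One exceptional set serves all three assertions of the main theorem: nonconjugate points with
the same class force `d` to be even, different from `2`, and twice the degree of the image. -/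
theorem finite_degree_eq_and_not [CharZero k] {π : C.toScheme ⟶ E.toScheme}
    (hπ : IsBiellipticMap π) (hJ : Finite C.jacobianRationalPoints) {d : ℕ} (hd : 2 ≤ d)
    (hdg : d + 2 ≤ C.genus) :
    {P : C.AlgPoints | P.degree = d ∧
      ¬ (Even d ∧ d ≠ 2 ∧ (P.map π hπ.comp_str).degree = d / 2)}.Finite := by
  have horb : ∀ P : C.AlgPoints, P.degree = d →
      (P.orbit.Finite ∧ P.orbit.ncard = d) ∧
        (P.map π hπ.comp_str).orbit.ncard = (P.map π hπ.comp_str).degree := by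
    intro P hP
    have hfd : FiniteDimensional k P.field :=
      Module.finite_of_finrank_pos (by rw [show Module.finrank k P.field = d from hP]; omega)
    have hfd' : FiniteDimensional k (P.map π hπ.comp_str).field :=
      Module.Finite.of_injective
        (IntermediateField.inclusion (P.field_map_le π hπ.comp_str)).toLinearMap
        (IntermediateField.inclusion_injective (P.field_map_le π hπ.comp_str))
    exact ⟨hP ▸ P.finite_orbit_and_ncard, (Points.finite_orbit_and_ncard _).2⟩
  refine finite_of_finite_jacobianRationalPoints hJ (d := d)
    (fun P hP => (horb P hP.1).1.1) (fun P hP => (horb P hP.1).1.2) ?_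
  intro P hPS P' hPS' hprin
  obtain ⟨hP, hbad⟩ := hPS
  have hP' := hPS'.1
  by_contra hne
  have h1 := (horb P hP).1
  have h2 := (horb P' hP').1
  obtain ⟨h3, h4⟩ := orbit_ncard_eq_two_mul hπ h1.1 h2.1 hne (by rw [h2.2]; exact hdg) hprin
  -- Exchanging zeros and poles gives `d = 2 deg π(P')` as well. As `h4` says that `π(P')` has more
  -- than one conjugate, `d ≠ 2`.
  have h5 := (orbit_ncard_eq_two_mul hπ h2.1 h1.1 (fun h => hne (Points.mem_orbit_symm h))
    (by rw [h1.2]; exact hdg) (by rw [← neg_sub]; exact neg_mem hprin)).1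
  rw [h1.2, (horb P hP).2] at h3
  rw [h2.2] at h5
  refine hbad ⟨⟨_, h3.trans (two_mul _)⟩, ?_, ?_⟩ <;> omega

end Curve

end

theorem mainTheorem6 (C E : Curve ℚ) (π : C.toScheme ⟶ E.toScheme)
    (hπ : Curve.IsBiellipticMap π)
    (hJ : Finite C.jacobianRationalPoints)
    (d : ℕ) (hd : 2 ≤ d) (hdg : d + 2 ≤ C.genus) :
    {P : C.AlgPoints | P.degree = d ∧ P.IsPrimitive}.Finite ∧
    (d = 2 ∨ Odd d → {P : C.AlgPoints | P.degree = d}.Finite) ∧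
    (4 ≤ d → Even d →
      {P : C.AlgPoints | P.degree = d ∧
        ¬ ((P.map π hπ.comp_str).degree = d / 2 ∧ (P.map π hπ.comp_str).field ≤ P.field)}.Finite) := by
  have key := Curve.finite_degree_eq_and_not hπ hJ hd hdg
  refine ⟨key.subset ?_, fun h => key.subset ?_, fun h4 heven => key.subset ?_⟩
  · rintro P ⟨hP, hprim⟩
    refine ⟨hP, fun ⟨heven, hd2, hdeg⟩ => ?_⟩
    obtain ⟨m, hm⟩ := heven
    -- For a primitive point the field of the image has degree `1` or `d`; neither is `d / 2`,
    -- because `d` is positive, even and not `2`.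
    rcases hprim _ (P.field_map_le π hπ.comp_str) with h | h
    · rw [Curve.Points.degree, h, IntermediateField.finrank_bot] at hdeg
      omega
    · rw [Curve.Points.degree, h] at hdeg
      have : P.degree = d / 2 := hdeg
      omega
  · intro P hP
    refine ⟨hP, fun ⟨heven, hd2, _⟩ => ?_⟩
    rcases h with h | h
    · exact hd2 h
    · exact Nat.not_even_iff_odd.2 h heven
  · rintro P ⟨hP, hn⟩
    exact ⟨hP, fun h => hn ⟨h.2.2, P.field_map_le π hπ.comp_str⟩⟩
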